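/- Let $V_{\mathbb R}$ be a finite-dimensional real vector space with a scalar product, $V=\mathbb C\otimes V_{\mathbb R}$, $\ell=\dim V$, and let $W\subset O(V_{\mathbb R})$ be a finite group generated by reflections, with set of reflections $S$. For $s\in S$ let $\alpha_s$ be a root of $s$ (a nonzero vector orthogonal to its mirror). Let $c(s)$, $s\in S$, be independent formal parameters constant on $W$-conjugacy classes, $\mathbb C(c)$ the field of rational functions in them, and $S_c(V)=\mathbb C(c)\otimes S(V)$. The Dunkl operators on $S_c(V)$ are $$\nabla_y=\partial_y-\sum_{s\in S}c(s)\frac{\langle y,\alpha_s\rangle}{\alpha_s}(1-s),\qquad y\in V^*;$$ they commute, so that $\nabla_P$ is defined for $P\in S_c(V)\cong S_c(V^*)$ (identified by the scalar product) by $\nabla_{P+Q}=\nabla_P+\nabla_Q$, $\nabla_{PQ}=\nabla_P\nabla_Q$. Let $(f,g)_c$ be the constant term of $\nabla_f(g)$. Let $d_1\le\dots\le d_\ell$ be the degrees of $W$, i.e. the degrees of homogeneous elements $u_1,\dots,u_\ell$ such that $S(V)^W=\mathbb C[u_1,\dots,u_\ell]$ is a polynomial algebra (a homogeneous generating set, $\deg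 u_i=d_i$), and put $h=d_\ell$ if $\ell\ge 1$. For $a,a'\in\mathbb Z_{\ge0}^\ell$ write $a'\prec a$ if the last nonzero coordinate of $a-a'$ is positive. A canonical invariant $b_a$ is a homogeneous element of $S_c(V)^W$ such that for every homogeneous generating set $u_1,\dots,u_\ell$ one has $b_a\in\mathbb C^\times u^a+\sum_{a'\prec a}\mathbb C(c)u^{a'}$ and $(u^{a'},b_a)_c=0$ for all $a'\prec a$. Let $e_d^{(c)}$ denote $b_a$ for the $\prec$-largest $a$ with $\sum_i d_ia_i=d$. **Theorem.** Suppose that $d_1<\dots<d_\ell$ are pairwise distinct. Then canonical invariants $e_{d_1}^{(c)},\dots,e_{d_\ell}^{(c)}$ exist, and, for any choice of them: (a) The elements $e_{d_1}^{(c)},\dots,e_{d_\ell}^{(c)}$ generate the $\mathbb C(c)$-algebra $S_c(V)^W$. (b) For each $k$, the element $e_{d_k}^{(c)}$ of $S_c(V)^W$ is nonzero and homogeneous of degree $d_k$, and a homogeneous element $f\in S_c(V)^W$ of degree $d_k$ satisfies $\nabla_P(f)=0$ for all $P\in S_c(V)^W$ with zero constant term and $\deg P<d_k$ if and only if $f$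 is a $\mathbb C(c)$-multiple of $e_{d_k}^{(c)}$. (c) If $\ell\ge1$, then for each $k=1,2,\dots$ there is a canonical invariant $e_{kh}^{(c)}\in S_c(V)^W$, nonzero and homogeneous of degree $kh$, such that a homogeneous element $f\in S_c(V)^W$ of degree $kh$ satisfies $\nabla_P(f)=0$ for all $P\in S(V)^W$ with zero constant term and $\deg P<h$ if and only if $f$ is a $\mathbb C(c)$-multiple of $e_{kh}^{(c)}$. -/

import Mathlib

/-! Invariants of a finite real reflection group `W` acting on a Euclidean space `E`, and Dunkl
operators with formal parameters. An orthonormal basis `b` of `E` identifies the symmetric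
algebra of `k ⊗ E` with the polynomial ring `MvPolynomial (Fin ℓ) k`, the basis vector `b i`
corresponding to the variable `X i`; it also identifies `E` with its dual. -/

open MvPolynomial

noncomputable section

namespace Dunkl

variable {E : Type*} [NormedAddCommGroup E] [InnerProductSpace ℝ E] {ℓ : ℕ}

/-- A vector `v`, as a linear element of the symmetric algebra with coefficients in `k`. -/
def linForm (k : Type*) [CommRing k] [Algebra ℝ k] (b : OrthonormalBasis (Fin ℓ) ℝ E) (v : E) :
    MvPolynomial (Fin ℓ) k :=
  ∑ i, C (algebraMap ℝ k (inner ℝ (b i) v)) * X i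

/-- The action of an isometry `w` on the symmetric algebra: the algebra endomorphism that
extends the action of `w` on vectors. -/
def act (k : Type*) [CommRing k] [Algebra ℝ k] (b : OrthonormalBasis (Fin ℓ) ℝ E)
    (w : E ≃ₗᵢ[ℝ] E) : MvPolynomial (Fin ℓ) k →ₐ[k] MvPolynomial (Fin ℓ) k :=
  aeval fun j => linForm k b (w (b j))

/-- The algebra of `W`-invariants. -/
def invariants (k : Type*) [CommRing k] [Algebra ℝ k] (b : OrthonormalBasis (Fin ℓ) ℝ E)
    (W : Subgroup (E ≃ₗᵢ[ℝ] E)) : Subalgebra k (MvPolynomial (Fin ℓ) k) where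
  carrier := {f | ∀ w ∈ W, act k b w f = f}
  mul_mem' := fun hf hg w hw => by rw [map_mul, hf w hw, hg w hw]
  add_mem' := fun hf hg w hw => by rw [map_add, hf w hw, hg w hw]
  algebraMap_mem' := fun r w _ => (act k b w).commutes r

/-- The orthogonal reflection in the hyperplane `α^⊥`. -/
def reflectionIn (α : E) : E ≃ₗᵢ[ℝ] E := (ℝ ∙ α)ᗮ.reflection

/-- `s` is the orthogonal reflection in some hyperplane. -/
def IsReflection (s : E ≃ₗᵢ[ℝ] E) : Prop := ∃ α : E, α ≠ 0 ∧ s = reflectionIn α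

/-- The set `S` of reflections in `W`. -/
abbrev Refl (W : Subgroup (E ≃ₗᵢ[ℝ] E)) : Type _ := {s : W // IsReflection (s : E ≃ₗᵢ[ℝ] E)}

/-- The set `S / W` of orbits of `W` acting on its reflections by conjugation. -/
abbrev ReflClass (W : Subgroup (E ≃ₗᵢ[ℝ] E)) : Type _ :=
  Quotient ((IsConj.setoid W).comap (fun s : Refl W => s.1))

/-- The field `ℂ(c)` of rational functions in independent variables indexed by `S / W`. -/
abbrev ParamField (W : Subgroup (E ≃ₗᵢ[ℝ] E)) : Type _ :=
  FractionRing (MvPolynomial (ReflClass W) ℂ)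

/-- The parameter `c(s)`: the variable of the class of the reflection `s`. -/
def param (W : Subgroup (E ≃ₗᵢ[ℝ] E)) (s : Refl W) : ParamField W :=
  algebraMap (MvPolynomial (ReflClass W) ℂ) (ParamField W) (X (Quotient.mk _ s))

/-- A root of the reflection `s`: a nonzero vector orthogonal to its mirror (determined up to a
nonzero scalar, which does not affect the Dunkl operators). -/
def root {W : Subgroup (E ≃ₗᵢ[ℝ] E)} (s : Refl W) : E := s.2.choose

theorem root_ne_zero {W : Subgroup (E ≃ₗᵢ[ℝ] E)} (s : Refl W) : root s ≠ 0 :=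
  s.2.choose_spec.1

theorem eq_reflectionIn_root {W : Subgroup (E ≃ₗᵢ[ℝ] E)} (s : Refl W) :
    (s : E ≃ₗᵢ[ℝ] E) = reflectionIn (root s) :=
  s.2.choose_spec.2

section DividedDifference

variable (k : Type*) [Field k] [Algebra ℝ k] (b : OrthonormalBasis (Fin ℓ) ℝ E)

theorem linForm_add (v w : E) : linForm k b (v + w) = linForm k b v + linForm k b w := by
  simp [linForm, inner_add_right, add_mul, Finset.sum_add_distrib]

theorem linForm_smul (r : ℝ) (v : E) :
    linForm k b (r • v) = C (algebraMap ℝ k r) * linForm k b v := by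
  simp [linForm, inner_smul_right, Finset.mul_sum, mul_assoc]

theorem linForm_basis (j : Fin ℓ) : linForm k b (b j) = X j := by
  simp [linForm, orthonormal_iff_ite.mp b.orthonormal]

theorem linForm_ne_zero {v : E} (hv : v ≠ 0) : linForm k b v ≠ 0 := by
  intro h
  apply hv
  refine b.repr.map_eq_zero_iff.mp (PiLp.ext fun i => ?_)
  have h1 := congrArg (MvPolynomial.coeff (Finsupp.single i 1)) h
  simp only [linForm, coeff_sum, coeff_C_mul, coeff_X, coeff_zero] at h1
  simp [Finsupp.single_left_inj] at h1
  simpa [b.repr_apply_apply] using h1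

theorem linForm_dvd (α : E) (f : MvPolynomial (Fin ℓ) k) :
    linForm k b α ∣ f - act k b (reflectionIn α) f := by
  induction f using MvPolynomial.induction_on with
  | C r => simp [act]
  | add p q hp hq =>
    rw [map_add, add_sub_add_comm]
    exact dvd_add hp hq
  | mul_X p j hp =>
    have hj : linForm k b α ∣ X j - act k b (reflectionIn α) (X j) := by
      obtain ⟨r, hr⟩ : ∃ r : ℝ, b j = reflectionIn α (b j) + r • α := by
        refine ⟨2 * (inner ℝ α (b j) / ((‖α‖ : ℝ) ^ 2)), ?_⟩
        rw [reflectionIn, Submodule.reflection_orthogonal_apply,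
          Submodule.reflection_singleton_apply]
        simp [mul_smul, two_smul]
      have : (X j : MvPolynomial (Fin ℓ) k)
          = act k b (reflectionIn α) (X j) + C (algebraMap ℝ k r) * linForm k b α := by
        rw [← linForm_smul, act, aeval_X, ← linForm_add, ← hr, linForm_basis]
      exact ⟨C (algebraMap ℝ k r), by linear_combination this⟩
    have : p * X j - act k b (reflectionIn α) (p * X j)
        = (p - act k b (reflectionIn α) p) * X j
          + act k b (reflectionIn α) p * (X j - act k b (reflectionIn α) (X j)) := by
      rw [map_mul]; ring
    rw [this]
    exact dvd_add (hp.mul_right _) (hj.mul_left _)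

/-- The operator `f ↦ (f - s f) / α`, where `s` is the reflection in `α^⊥`: the value at `f` is
the unique polynomial whose product with the linear form `α` is `f - s f`. -/
def dividedDiff (α : E) (hα : α ≠ 0) :
    MvPolynomial (Fin ℓ) k →ₗ[k] MvPolynomial (Fin ℓ) k where
  toFun f := (linForm_dvd k b α f).choose
  map_add' f g := by
    refine mul_left_cancel₀ (linForm_ne_zero k b hα) ?_
    rw [mul_add, ← (linForm_dvd k b α f).choose_spec, ← (linForm_dvd k b α g).choose_spec,
      ← (linForm_dvd k b α (f + g)).choose_spec, map_add]
    ring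
  map_smul' r f := by
    refine mul_left_cancel₀ (linForm_ne_zero k b hα) ?_
    rw [RingHom.id_apply, mul_smul_comm, ← (linForm_dvd k b α f).choose_spec,
      ← (linForm_dvd k b α (r • f)).choose_spec, map_smul, smul_sub]

end DividedDifference

section Operators

variable (b : OrthonormalBasis (Fin ℓ) ℝ E) (W : Subgroup (E ≃ₗᵢ[ℝ] E))

/-- The algebra `S_c(V)`: polynomials with coefficients in `ℂ(c)`. -/
abbrev Sc (ℓ : ℕ) (W : Subgroup (E ≃ₗᵢ[ℝ] E)) : Type _ := MvPolynomial (Fin ℓ) (ParamField W)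

/-- The inclusion of `S(V)` into `S_c(V)`. -/
def toSc (ℓ : ℕ) (W : Subgroup (E ≃ₗᵢ[ℝ] E)) : MvPolynomial (Fin ℓ) ℂ →+* Sc ℓ W :=
  MvPolynomial.map (algebraMap ℂ (ParamField W))

/-- The directional derivative `∂_y`: the derivation with `∂_y v = ⟨y, v⟩` for vectors `v`. -/
def dirDeriv (y : E) : Module.End (ParamField W) (Sc ℓ W) :=
  (mkDerivation (ParamField W)
    (fun i => (C (algebraMap ℝ (ParamField W) (inner ℝ y (b i))) : Sc ℓ W))).toLinearMap

/-- The Dunkl operator `∇_y = ∂_y - ∑_{s ∈ S} c(s) (⟨y, α_s⟩ / α_s) (1 - s)`. -/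
def dunklOp (y : E) : Module.End (ParamField W) (Sc ℓ W) :=
  dirDeriv b W y - ∑ᶠ s : Refl W,
    (param W s * algebraMap ℝ (ParamField W) (inner ℝ y (root s))) •
      dividedDiff (ParamField W) b (root s) (root_ne_zero s)

/-- The operator `∇_p` for a polynomial `p`, obtained from `p` by substituting the Dunkl operator
`∇_{b i}` for the variable `X i`. (Dunkl operators commute, so the order of the factors, here
that of increasing indices, is immaterial, and `∇_{pq} = ∇_p ∇_q`.) -/
def dunklPoly (p : Sc ℓ W) : Module.End (ParamField W) (Sc ℓ W) :=
  ∑ m ∈ p.support, p.coeff m • (List.ofFn fun i => dunklOp b W (b i) ^ m i).prod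

/-- The form `(f, g)_c`, the constant term of `∇_f g`. -/
def dunklForm (f g : Sc ℓ W) : ParamField W := constantCoeff (dunklPoly b W f g)

/-- `u` is a homogeneous generating set of `S(V)^W` with degrees `d`: the `u i` are homogeneous
of degree `d i`, and `S(V)^W` is the algebra of polynomials in the `u i`. -/
def IsHomogeneousGeneratingSet (d : Fin ℓ → ℕ) (u : Fin ℓ → MvPolynomial (Fin ℓ) ℂ) : Prop :=
  (∀ i, (u i).IsHomogeneous (d i)) ∧ AlgebraicIndependent ℂ u ∧
    Algebra.adjoin ℂ (Set.range u) = invariants ℂ b W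

open Classical in
/-- The degrees `d_1 ≤ ⋯ ≤ d_ℓ` of `W`: the degrees of a homogeneous generating set of `S(V)^W`
in increasing order. Such sets exist for finite reflection groups by Chevalley's theorem, and
their degrees do not depend on any choice. -/
def degrees : Fin ℓ → ℕ :=
  if h : ∃ d : Fin ℓ → ℕ, Monotone d ∧ ∃ u, IsHomogeneousGeneratingSet b W d u then h.choose
  else 0

/-- The inverse lexicographic order `a' ≺ a`: the last nonzero coordinate of `a - a'` is
positive. -/
def Prec (a' a : Fin ℓ → ℕ) : Prop := ∃ i, a' i < a i ∧ ∀ j, i < j → a' j = a j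

/-- The monomial `u^a` in the elements `u i`, viewed in `S_c(V)`. -/
def monom (u : Fin ℓ → MvPolynomial (Fin ℓ) ℂ) (a : Fin ℓ → ℕ) : Sc ℓ W :=
  toSc ℓ W (∏ i, u i ^ a i)

/-- `f` is a canonical invariant `b_a`: a homogeneous element of `S_c(V)^W` such that, for every
homogeneous generating set `u` of `S(V)^W`, `f` lies in `ℂ^× u^a + ∑_{a' ≺ a} ℂ(c) u^{a'}` and is
orthogonal to every `u^{a'}` with `a' ≺ a`. -/
def IsCanonicalInvariant (a : Fin ℓ → ℕ) (f : Sc ℓ W) : Prop :=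
  f ∈ invariants (ParamField W) b W ∧ (∃ n, f.IsHomogeneous n) ∧
    ∀ u, IsHomogeneousGeneratingSet b W (degrees b W) u →
      (∃ z : ℂ, z ≠ 0 ∧
        f - z • monom W u a ∈
          Submodule.span (ParamField W) {g | ∃ a', Prec a' a ∧ g = monom W u a'}) ∧
      ∀ a', Prec a' a → dunklForm b W (monom W u a') f = 0

/-- `f` is a canonical invariant `e_n^{(c)}`, i.e. `b_a` where `a` is the largest element, in the
inverse lexicographic order, of the set of all `a` with `∑ d_i a_i = n`. -/
def IsElementary (n : ℕ) (f : Sc ℓ W) : Prop :=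
  ∃ a : Fin ℓ → ℕ, ∑ i, degrees b W i * a i = n ∧
    (∀ a' : Fin ℓ → ℕ, ∑ i, degrees b W i * a' i = n → a' = a ∨ Prec a' a) ∧
    IsCanonicalInvariant b W a f

end Operators

end Dunkl

end

/-! The commutator of two Dunkl operators commutes with multiplication by vectors and annihilates
constants, so it is zero, and `(f, g)_c` satisfies `(p q, g)_c = (q, ∇_p g)_c`. Its values on
elements of `S(V)` are polynomials in the parameters, and at `c = 0` it becomes the Fischer pairing,
which is positive on pairs of an element and its complex conjugate. A Gram determinant that does
not vanish at `c = 0` is nonzero in `ℂ(c)`; hence the form is nondegenerate on every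
finite-dimensional subspace spanned by elements of `S(V)` whose complex conjugates it contains, and
canonical invariants arise by orthogonalizing `u^a` against the lower monomials of its degree.

When the degrees are distinct, two homogeneous generating sets differ by a triangular substitution,
which preserves the span of the monomials below a largest exponent; so one generating set suffices.
The adjointness above turns orthogonality to lower monomials into the Dunkl equations: a monomial
of degree `d_k` other than `u_k`, or of degree `k h` other than a power of `u_ℓ`, has a generator of
smaller degree as a factor. A solution is thus orthogonal to all lower monomials, and nondegeneracy
leaves only the multiples of `e`. -/

noncomputable section

namespace Dunkl

section Polynomial

variable {σ k : Type*}

theorem homogeneousComponent_mul_of_isHomogeneous_left [CommSemiring k] {p : MvPolynomial σ k}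
    {m : ℕ} (hp : p.IsHomogeneous m) (q : MvPolynomial σ k) (n : ℕ) :
    homogeneousComponent (m + n) (p * q) = p * homogeneousComponent n q := by
  let := gradedAlgebra (σ := σ) (R := k)
  simp only [← decomposition.decompose'_apply]
  exact DirectSum.coe_decompose_mul_add_of_left_mem (homogeneousSubmodule σ k) hp

theorem isHomogeneous_of_mul_left [CommRing k] [IsDomain k] {p q : MvPolynomial σ k} {m n : ℕ}
    (hp : p.IsHomogeneous m) (hp0 : p ≠ 0) (hpq : (p * q).IsHomogeneous (m + n)) :
    q.IsHomogeneous n := by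
  have hcomp : ∀ j ≠ n, homogeneousComponent j q = 0 := fun j hj => by
    have h := homogeneousComponent_mul_of_isHomogeneous_left hp q j
    rw [homogeneousComponent_of_mem hpq, if_neg (by omega)] at h
    exact (mul_eq_zero.mp h.symm).resolve_left hp0
  rw [← sum_homogeneousComponent q]
  refine IsHomogeneous.sum _ _ _ fun j _ => ?_
  by_cases hj : j = n
  · exact hj ▸ homogeneousComponent_isHomogeneous j q
  · rw [hcomp j hj]
    exact isHomogeneous_zero σ k n

theorem homogeneousComponent_mem_span [CommSemiring k] {ι : Type*} {v : ι → MvPolynomial σ k}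
    {δ : ι → ℕ} (hv : ∀ i, (v i).IsHomogeneous (δ i)) {f : MvPolynomial σ k}
    (hf : f ∈ Submodule.span k (Set.range v)) (n : ℕ) :
    homogeneousComponent n f ∈ Submodule.span k (v '' {i | δ i = n}) := by
  induction hf using Submodule.span_induction with
  | mem x hx =>
    obtain ⟨i, rfl⟩ := hx
    rw [homogeneousComponent_of_mem (hv i)]
    split_ifs with h
    · exact Submodule.subset_span ⟨i, h.symm, rfl⟩
    · exact zero_mem _
  | zero => rw [map_zero]; exact zero_mem _
  | add x y _ _ hx hy => rw [map_add]; exact add_mem hx hy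
  | smul r x _ hx => rw [map_smul]; exact Submodule.smul_mem _ r hx

end Polynomial

section Substitution

variable {σ k A : Type*} [CommRing k] [Ring A] [Algebra k A]

/-- Substitution of pairwise commuting elements `T i` of a not necessarily commutative algebra
for the variables of a polynomial. -/
def evalCommuting (T : σ → A) (hT : ∀ i j, Commute (T i) (T j)) : MvPolynomial σ k →ₐ[k] A :=
  let hcomm := Algebra.isMulCommutative_adjoin k (s := Set.range T) (by
    rintro _ ⟨i, rfl⟩ _ ⟨j, rfl⟩
    exact hT i j)
  let _ : CommRing (Algebra.adjoin k (Set.range T)) :=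
    { (inferInstance : Ring (Algebra.adjoin k (Set.range T))) with
      mul_comm := hcomm.is_comm.comm }
  (Algebra.adjoin k (Set.range T)).val.comp
    (aeval fun i => ⟨T i, Algebra.subset_adjoin (Set.mem_range_self i)⟩)

@[simp]
theorem evalCommuting_X (T : σ → A) (hT : ∀ i j, Commute (T i) (T j)) (i : σ) :
    evalCommuting (k := k) T hT (X i) = T i := by
  simp [evalCommuting]

theorem evalCommuting_eq_sum {n : ℕ} (T : Fin n → A) (hT : ∀ i j, Commute (T i) (T j))
    (p : MvPolynomial (Fin n) k) :
    evalCommuting T hT p =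
      ∑ m ∈ p.support, p.coeff m • (List.ofFn fun i => T i ^ m i).prod := by
  conv_lhs => rw [p.as_sum, map_sum]
  refine Finset.sum_congr rfl fun m _ => ?_
  rw [monomial_eq, Finsupp.prod_fintype _ _ fun i => pow_zero (X i), ← smul_eq_C_mul, map_smul,
    ← List.prod_ofFn, map_list_prod, List.map_ofFn]
  simp only [Function.comp_def, map_pow, evalCommuting_X]

end Substitution

section Lowering

variable {σ k : Type*} [CommRing k]

/-- The operators on polynomials that lower the degree by `d`, annihilating what has degree less
than `d`. -/
def lowering (σ k : Type*) [CommRing k] (d : ℕ) :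
    Submodule k (Module.End k (MvPolynomial σ k)) where
  carrier := {T | (∀ n f, f.IsHomogeneous (n + d) → (T f).IsHomogeneous n) ∧
    ∀ n < d, ∀ f, f.IsHomogeneous n → T f = 0}
  add_mem' hS hT := ⟨fun n f hf => (hS.1 n f hf).add (hT.1 n f hf), fun n hn f hf => by
    rw [LinearMap.add_apply, hS.2 n hn f hf, hT.2 n hn f hf, add_zero]⟩
  zero_mem' := ⟨fun n _ _ => isHomogeneous_zero σ k n, fun _ _ _ _ => rfl⟩
  smul_mem' r T hT := ⟨fun n f hf => (homogeneousSubmodule σ k n).smul_mem r (hT.1 n f hf),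
    fun n hn f hf => by rw [LinearMap.smul_apply, hT.2 n hn f hf, smul_zero]⟩

instance lowering.gradedMonoid : SetLike.GradedMonoid (lowering σ k) where
  one_mem := ⟨fun _ _ hf => hf, fun _ hn => absurd hn (Nat.not_lt_zero _)⟩
  mul_mem i j S T hS hT := by
    refine ⟨fun n f hf => hS.1 n _ (hT.1 _ f (by rwa [add_assoc])), fun n hn f hf => ?_⟩
    rw [Module.End.mul_apply]
    rcases lt_or_ge n j with h | h
    · rw [hT.2 n h f hf, map_zero]
    · exact hS.2 (n - j) (by omega) _ (hT.1 _ f (by rwa [Nat.sub_add_cancel h]))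

theorem mem_lowering_one {T : Module.End k (MvPolynomial σ k)}
    (hT : ∀ n f, f.IsHomogeneous (n + 1) → (T f).IsHomogeneous n) (hC : ∀ r, T (C r) = 0) :
    T ∈ lowering σ k 1 := by
  refine ⟨hT, fun n hn f hf => ?_⟩
  rw [Nat.lt_one_iff.mp hn, ← totalDegree_zero_iff_isHomogeneous] at hf
  rw [totalDegree_eq_zero_iff_eq_C.mp hf, hC]

theorem pderiv_mem_lowering (i : σ) : (pderiv i).toLinearMap ∈ lowering σ k 1 :=
  mem_lowering_one (fun _ _ hf => hf.pderiv) fun _ => pderiv_C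

theorem evalCommuting_mem_lowering {n d : ℕ} {T : Fin n → Module.End k (MvPolynomial σ k)}
    (hT : ∀ i j, Commute (T i) (T j)) (hlow : ∀ i, T i ∈ lowering σ k 1)
    {p : MvPolynomial (Fin n) k} (hp : p.IsHomogeneous d) :
    evalCommuting T hT p ∈ lowering σ k d := by
  rw [evalCommuting_eq_sum]
  refine sum_mem fun m hm => Submodule.smul_mem _ _ ?_
  have hd : (List.ofFn fun i => m i • 1).sum = d := by
    simp only [smul_eq_mul, mul_one, List.sum_ofFn, ← Finsupp.degree_eq_sum]
    exact (hp.degree_eq_sum_deg_support hm).symm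
  rw [← hd]
  exact SetLike.list_prod_ofFn_mem_graded _ _ fun i => SetLike.pow_mem_graded (m i) (hlow i)

theorem constantCoeff_apply_eq_zero_of_mem_lowering {d n : ℕ}
    {T : Module.End k (MvPolynomial σ k)} (hT : T ∈ lowering σ k d) {f : MvPolynomial σ k}
    (hf : f.IsHomogeneous n) (hdn : d ≠ n) : constantCoeff (T f) = 0 := by
  rcases hdn.lt_or_gt with h | h
  · obtain ⟨m, rfl⟩ := Nat.exists_eq_add_of_lt h
    refine (hT.1 (m + 1) f (by rwa [add_comm, ← add_assoc])).coeff_eq_zero ?_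
    rw [map_zero]
    exact (Nat.succ_ne_zero m).symm
  · rw [hT.2 n h f hf, map_zero]

end Lowering

section Fischer

variable {σ : Type*}

theorem pderiv_pderiv_comm {k : Type*} [CommRing k] (i j : σ) (f : MvPolynomial σ k) :
    pderiv i (pderiv j f) = pderiv j (pderiv i f) := by
  have h : ⁅(pderiv i : Derivation k (MvPolynomial σ k) (MvPolynomial σ k)), pderiv j⁆ = 0 :=
    derivation_ext fun l => by
      classical
      rw [Derivation.commutator_apply]
      simp [pderiv_X, Pi.single_apply, apply_ite]
  rw [← sub_eq_zero, ← Derivation.commutator_apply, h, Derivation.zero_apply]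

/-- The constant-coefficient differential operator `p(∂)` with symbol `p`. -/
def diffPoly (σ k : Type*) [CommRing k] :
    MvPolynomial σ k →ₐ[k] Module.End k (MvPolynomial σ k) :=
  evalCommuting (fun i => (pderiv i).toLinearMap) fun i j => LinearMap.ext (pderiv_pderiv_comm i j)

theorem diffPoly_X_apply {k : Type*} [CommRing k] (i : σ) (f : MvPolynomial σ k) :
    diffPoly σ k (X i) f = pderiv i f :=
  LinearMap.congr_fun (evalCommuting_X _ _ i) f

theorem exists_constantCoeff_diffPoly_monomial {k : Type*} [CommRing k] (m : σ →₀ ℕ) :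
    ∃ r : ℕ, 0 < r ∧
      ∀ g, constantCoeff (diffPoly σ k (monomial m 1) g) = r * coeff m g := by
  induction hd : m.degree generalizing m with
  | zero =>
    rw [Finsupp.degree_eq_zero_iff] at hd
    exact ⟨1, one_pos, fun g => by simp [hd, constantCoeff_eq]⟩
  | succ d ih =>
    obtain ⟨i, hi⟩ : ∃ i, m i ≠ 0 := by
      by_contra! h
      simp [show m = 0 from Finsupp.ext h] at hd
    obtain ⟨m, rfl⟩ : ∃ m', m = m' + Finsupp.single i 1 :=
      ⟨_, (tsub_add_cancel_of_le
        (Finsupp.single_le_iff.mpr (Nat.one_le_iff_ne_zero.mpr hi))).symm⟩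
    obtain ⟨r, hr, h⟩ := ih m (by simpa using hd)
    refine ⟨r * (m i + 1), by positivity, fun g => ?_⟩
    rw [monomial_add_single, pow_one, map_mul, Module.End.mul_apply, h, diffPoly_X_apply,
      coeff_pderiv]
    push_cast
    ring

/-- Complex conjugation of the coefficients. -/
def conjPoly (σ : Type*) : MvPolynomial σ ℂ →+* MvPolynomial σ ℂ :=
  MvPolynomial.map (starRingEnd ℂ)

theorem conjPoly_smul (z : ℂ) (f : MvPolynomial σ ℂ) :
    conjPoly σ (z • f) = starRingEnd ℂ z • conjPoly σ f := by
  rw [smul_eq_C_mul, map_mul, conjPoly, map_C, smul_eq_C_mul]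

theorem constantCoeff_diffPoly_conjPoly_ne_zero {g : MvPolynomial σ ℂ} (hg : g ≠ 0) :
    constantCoeff (diffPoly σ ℂ (conjPoly σ g) g) ≠ 0 := by
  choose r hr h using exists_constantCoeff_diffPoly_monomial (σ := σ) (k := ℂ)
  have hsupp : (conjPoly σ g).support = g.support :=
    support_map_of_injective g (starRingEnd ℂ).injective
  have hsum : constantCoeff (diffPoly σ ℂ (conjPoly σ g) g) =
      ((∑ m ∈ g.support, r m * Complex.normSq (coeff m g) : ℝ) : ℂ) := by
    conv_lhs => rw [(conjPoly σ g).as_sum, hsupp]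
    simp only [map_sum, LinearMap.sum_apply, Complex.ofReal_sum]
    refine Finset.sum_congr rfl fun m _ => ?_
    rw [← mul_one (coeff m (conjPoly σ g)), ← smul_eq_mul, ← smul_monomial, map_smul,
      LinearMap.smul_apply, constantCoeff_smul, h, conjPoly, coeff_map, Complex.ofReal_mul,
      ← Complex.mul_conj, Complex.ofReal_natCast, smul_eq_mul]
    ring
  rw [hsum, Complex.ofReal_ne_zero]
  refine (Finset.sum_pos (fun m hm => ?_) (support_nonempty.mpr hg)).ne'
  exact mul_pos (Nat.cast_pos.mpr (hr m)) (Complex.normSq_pos.mpr (mem_support_iff.mp hm))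

end Fischer

variable {E : Type*} [NormedAddCommGroup E] [InnerProductSpace ℝ E] {ℓ : ℕ}

section Action

variable (k : Type*) [CommRing k] [Algebra ℝ k] (b : OrthonormalBasis (Fin ℓ) ℝ E)

theorem linForm_isHomogeneous (v : E) : (linForm k b v).IsHomogeneous 1 :=
  IsHomogeneous.sum _ _ _ fun i _ => (isHomogeneous_X k i).C_mul _

theorem act_X (w : E ≃ₗᵢ[ℝ] E) (j : Fin ℓ) : act k b w (X j) = linForm k b (w (b j)) :=
  aeval_X _ j

theorem act_C (w : E ≃ₗᵢ[ℝ] E) (r : k) : act k b w (C r) = C r :=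
  (act k b w).commutes r

theorem act_isHomogeneous (w : E ≃ₗᵢ[ℝ] E) {f : MvPolynomial (Fin ℓ) k} {n : ℕ}
    (hf : f.IsHomogeneous n) : (act k b w f).IsHomogeneous n :=
  one_mul n ▸ hf.aeval _ fun i => linForm_isHomogeneous k b (w (b i))

end Action

section ActionField

variable (k : Type*) [Field k] [Algebra ℝ k] (b : OrthonormalBasis (Fin ℓ) ℝ E)

theorem act_linForm (w : E ≃ₗᵢ[ℝ] E) (v : E) :
    act k b w (linForm k b v) = linForm k b (w v) := by
  have hsum (v : Fin ℓ → E) : linForm k b (∑ i, v i) = ∑ i, linForm k b (v i) :=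
    map_sum (AddMonoidHom.mk' (linForm k b) (linForm_add k b)) v _
  conv_rhs => rw [← b.sum_repr v, map_sum, hsum]
  rw [linForm, map_sum]
  refine Finset.sum_congr rfl fun i _ => ?_
  rw [map_mul, act_C, act_X, map_smul, linForm_smul, b.repr_apply_apply]

theorem act_mul_apply (w w' : E ≃ₗᵢ[ℝ] E) (f : MvPolynomial (Fin ℓ) k) :
    act k b (w * w') f = act k b w (act k b w' f) := by
  suffices h : act k b (w * w') = (act k b w).comp (act k b w') by rw [h]; rfl
  refine MvPolynomial.algHom_ext fun j => ?_
  rw [AlgHom.comp_apply, act_X, act_X, act_linForm]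
  rfl

end ActionField

section Reflection

/-- The coefficient `2⟨α, v⟩ / ⟨α, α⟩` of `α` in `v - s v`, where `s` is the reflection in `α^⊥`. -/
def corootPairing (α v : E) : ℝ := 2 * inner ℝ α v / inner ℝ α α

theorem reflectionIn_apply (α v : E) : reflectionIn α v = v - corootPairing α v • α := by
  rw [reflectionIn, Submodule.reflection_orthogonal_apply,
    Submodule.reflection_singleton_apply, corootPairing, real_inner_self_eq_norm_sq]
  simp only [RCLike.ofReal_real_eq_id, id]
  rw [mul_div_assoc, mul_smul, neg_sub, two_smul ℝ, two_smul ℕ]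

theorem conj_reflectionIn (w : E ≃ₗᵢ[ℝ] E) (α : E) :
    w * reflectionIn α * w⁻¹ = reflectionIn (w α) := by
  ext v
  have hv : w (w⁻¹ v) = v := w.apply_symm_apply v
  have hinner : (inner ℝ α (w⁻¹ v) : ℝ) = inner ℝ (w α) v := by
    rw [← w.inner_map_map, hv]
  rw [LinearIsometryEquiv.coe_mul, LinearIsometryEquiv.coe_mul, Function.comp_apply,
    Function.comp_apply, reflectionIn_apply, reflectionIn_apply, map_sub, map_smul, hv,
    corootPairing, corootPairing, hinner, w.inner_map_map]

theorem reflectionIn_self {α : E} (hα : α ≠ 0) : reflectionIn α α = -α := by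
  rw [reflectionIn_apply, corootPairing, mul_div_assoc, div_self (inner_self_ne_zero.mpr hα),
    mul_one, two_smul, sub_add_cancel_left]

theorem IsReflection.conj {s : E ≃ₗᵢ[ℝ] E} (hs : IsReflection s) (w : E ≃ₗᵢ[ℝ] E) :
    IsReflection (w * s * w⁻¹) := by
  obtain ⟨α, hα, rfl⟩ := hs
  exact ⟨w α, by simpa using hα, conj_reflectionIn w α⟩

theorem exists_eq_smul_of_reflectionIn_eq {α β : E} (hα : α ≠ 0)
    (h : reflectionIn α = reflectionIn β) : ∃ r : ℝ, α = r • β := by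
  have hneg := reflectionIn_self hα
  rw [h, reflectionIn_apply, sub_eq_iff_eq_add, eq_neg_add_iff_add_eq, ← two_smul ℝ] at hneg
  exact ⟨2⁻¹ * corootPairing β α, by
    rw [mul_smul, ← hneg, smul_smul, inv_mul_cancel₀ two_ne_zero, one_smul]⟩

variable (k : Type*) [Field k] [Algebra ℝ k] (b : OrthonormalBasis (Fin ℓ) ℝ E)

theorem linForm_mul_dividedDiff {α : E} (hα : α ≠ 0) (f : MvPolynomial (Fin ℓ) k) :
    linForm k b α * dividedDiff k b α hα f = f - act k b (reflectionIn α) f :=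
  (linForm_dvd k b α f).choose_spec.symm

theorem dividedDiff_eq {α : E} (hα : α ≠ 0) {f g : MvPolynomial (Fin ℓ) k}
    (h : linForm k b α * g = f - act k b (reflectionIn α) f) : dividedDiff k b α hα f = g :=
  mul_left_cancel₀ (linForm_ne_zero k b hα) ((linForm_mul_dividedDiff k b hα f).trans h.symm)

theorem dividedDiff_C {α : E} (hα : α ≠ 0) (r : k) : dividedDiff k b α hα (C r) = 0 :=
  dividedDiff_eq k b hα (by rw [act_C, sub_self, mul_zero])

theorem dividedDiff_linForm_mul {α : E} (hα : α ≠ 0) (v : E) (f : MvPolynomial (Fin ℓ) k) :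
    dividedDiff k b α hα (linForm k b v * f) = linForm k b v * dividedDiff k b α hα f +
      C (algebraMap ℝ k (corootPairing α v)) * act k b (reflectionIn α) f := by
  refine dividedDiff_eq k b hα ?_
  have hdiff := linForm_mul_dividedDiff k b hα f
  have hv : linForm k b v = act k b (reflectionIn α) (linForm k b v)
      + C (algebraMap ℝ k (corootPairing α v)) * linForm k b α := by
    rw [act_linForm, ← linForm_smul, ← linForm_add, reflectionIn_apply, sub_add_cancel]
  rw [map_mul]
  linear_combination linForm k b v * hdiff - act k b (reflectionIn α) f * hv

theorem act_dividedDiff (w : E ≃ₗᵢ[ℝ] E) {α : E} (hα : α ≠ 0) (hwα : w α ≠ 0)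
    (f : MvPolynomial (Fin ℓ) k) :
    act k b w (dividedDiff k b α hα f) = dividedDiff k b (w α) hwα (act k b w f) := by
  refine (dividedDiff_eq k b hwα ?_).symm
  rw [← act_linForm, ← map_mul, linForm_mul_dividedDiff, map_sub, ← act_mul_apply,
    ← conj_reflectionIn, ← act_mul_apply, inv_mul_cancel_right]

theorem smul_dividedDiff_of_eq_smul {α β : E} (hα : α ≠ 0) (hβ : β ≠ 0) {r : ℝ}
    (hs : reflectionIn α = reflectionIn β) (hαβ : α = r • β) (f : MvPolynomial (Fin ℓ) k) :
    algebraMap ℝ k r • dividedDiff k b α hα f = dividedDiff k b β hβ f := by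
  refine (dividedDiff_eq k b hβ ?_).symm
  have hlin : linForm k b α = C (algebraMap ℝ k r) * linForm k b β := by rw [hαβ, linForm_smul]
  rw [← hs, ← linForm_mul_dividedDiff k b hα, hlin, smul_eq_C_mul]
  ring

theorem dividedDiff_mem_lowering {α : E} (hα : α ≠ 0) :
    dividedDiff k b α hα ∈ lowering (Fin ℓ) k 1 := by
  refine mem_lowering_one (fun n f hf => ?_) (dividedDiff_C k b hα)
  refine isHomogeneous_of_mul_left (linForm_isHomogeneous k b α) (linForm_ne_zero k b hα) ?_
  rw [linForm_mul_dividedDiff, add_comm]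
  exact hf.sub (act_isHomogeneous k b _ hf)

end Reflection

section DirectionalDerivative

variable (b : OrthonormalBasis (Fin ℓ) ℝ E) (W : Subgroup (E ≃ₗᵢ[ℝ] E))

theorem dirDeriv_X (y : E) (i : Fin ℓ) :
    dirDeriv b W y (X i) = C (algebraMap ℝ (ParamField W) (inner ℝ y (b i))) :=
  mkDerivation_X _ _ _

theorem dirDeriv_mul (y : E) (f g : Sc ℓ W) :
    dirDeriv b W y (f * g) = f * dirDeriv b W y g + g * dirDeriv b W y f :=
  Derivation.leibniz (mkDerivation (ParamField W) _) f g

theorem dirDeriv_C (y : E) (r : ParamField W) : dirDeriv b W y (C r) = 0 :=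
  mkDerivationₗ_C _ _

theorem dirDeriv_linForm (y v : E) :
    dirDeriv b W y (linForm _ b v) = C (algebraMap ℝ (ParamField W) (inner ℝ y v)) := by
  rw [linForm, map_sum]
  simp only [dirDeriv_mul, dirDeriv_X, dirDeriv_C, mul_zero, add_zero, ← map_mul, ← map_sum]
  rw [← b.sum_inner_mul_inner]
  simp only [mul_comm]

theorem act_dirDeriv (w : E ≃ₗᵢ[ℝ] E) (y : E) (f : Sc ℓ W) :
    act _ b w (dirDeriv b W y f) = dirDeriv b W (w y) (act _ b w f) := by
  induction f using MvPolynomial.induction_on with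
  | C r => rw [act_C, dirDeriv_C, dirDeriv_C, map_zero]
  | add p q hp hq => simp only [map_add, hp, hq]
  | mul_X p j hp =>
    rw [dirDeriv_mul, map_add, map_mul, map_mul, map_mul, dirDeriv_mul, hp, dirDeriv_X, act_C,
      act_X, dirDeriv_linForm, w.inner_map_map]

theorem dirDeriv_eq_sum_pderiv (y : E) :
    dirDeriv b W y =
      ∑ i, algebraMap ℝ (ParamField W) (inner ℝ y (b i)) • (pderiv i).toLinearMap := by
  refine LinearMap.ext fun f => ?_
  simp only [LinearMap.sum_apply, LinearMap.smul_apply, Derivation.coeFn_coe]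
  induction f using MvPolynomial.induction_on with
  | C r => simp [dirDeriv_C]
  | add p q hp hq => simp only [map_add, hp, hq, smul_add, Finset.sum_add_distrib]
  | mul_X p j hp =>
    rw [dirDeriv_mul, hp, dirDeriv_X]
    simp only [Derivation.leibniz, smul_add, Finset.sum_add_distrib, smul_eq_mul, pderiv_X,
      Finset.mul_sum, mul_smul_comm]
    simp [Pi.single_apply, mul_comm p, C_mul', -algebraMap_smul]

theorem dirDeriv_basis (i : Fin ℓ) (f : Sc ℓ W) : dirDeriv b W (b i) f = pderiv i f := by
  rw [dirDeriv_eq_sum_pderiv]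
  simp [orthonormal_iff_ite.mp b.orthonormal]

end DirectionalDerivative

section DunklOperator

variable (b : OrthonormalBasis (Fin ℓ) ℝ E) (W : Subgroup (E ≃ₗᵢ[ℝ] E))

/-- Conjugation `s ↦ w s w⁻¹` by `w`, as a permutation of the reflections of `W`. -/
def conjRefl (w : W) : Refl W ≃ Refl W :=
  (MulAut.conj w).toEquiv.subtypeEquiv fun s => ⟨fun h => h.conj w, fun h => by
    simpa [mul_assoc] using h.conj (w : E ≃ₗᵢ[ℝ] E)⁻¹⟩

theorem param_conjRefl (w : W) (s : Refl W) : param W (conjRefl W w s) = param W s := by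
  rw [param, param, Quotient.sound (s := (IsConj.setoid W).comap fun s : Refl W => s.1)
    (show IsConj (conjRefl W w s).1 s.1 from (isConj_iff.mpr ⟨w, rfl⟩).symm)]

theorem reflectionIn_root_conjRefl (w : W) (s : Refl W) :
    reflectionIn (root (conjRefl W w s)) = reflectionIn ((w : E ≃ₗᵢ[ℝ] E) (root s)) := by
  rw [← eq_reflectionIn_root, ← conj_reflectionIn, ← eq_reflectionIn_root]
  rfl

/-- The coefficient of the reflection `s` in the commutator of `∇_y` with multiplication by the
vector `x`. -/
def commutatorCoeff (y x : E) (s : Refl W) : ParamField W :=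
  param W s * algebraMap ℝ (ParamField W) (inner ℝ y (root s) * corootPairing (root s) x)

theorem commutatorCoeff_mul_corootPairing_comm (y z x : E) (s : Refl W) :
    commutatorCoeff W y x s * algebraMap ℝ (ParamField W) (corootPairing (root s) z) =
      commutatorCoeff W z x s * algebraMap ℝ (ParamField W) (corootPairing (root s) y) := by
  simp only [commutatorCoeff, mul_assoc, ← map_mul, corootPairing, real_inner_comm (root s)]
  congr 2
  ring

theorem dunklOp_eq_sub_sum [Fintype (Refl W)] (y : E) :
    dunklOp b W y = dirDeriv b W y - ∑ s : Refl W,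
      (param W s * algebraMap ℝ (ParamField W) (inner ℝ y (root s))) •
        dividedDiff (ParamField W) b (root s) (root_ne_zero s) := by
  rw [dunklOp, finsum_eq_sum_of_fintype]

theorem dunklOp_apply [Fintype (Refl W)] (y : E) (f : Sc ℓ W) :
    dunklOp b W y f = dirDeriv b W y f - ∑ s : Refl W,
      (param W s * algebraMap ℝ (ParamField W) (inner ℝ y (root s))) •
        dividedDiff (ParamField W) b (root s) (root_ne_zero s) f := by
  rw [dunklOp_eq_sub_sum, LinearMap.sub_apply, LinearMap.sum_apply]
  rfl

theorem dunklOp_linForm_mul [Fintype (Refl W)] (y x : E) (f : Sc ℓ W) :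
    dunklOp b W y (linForm _ b x * f) = linForm _ b x * dunklOp b W y f +
      algebraMap ℝ (ParamField W) (inner ℝ y x) • f -
        ∑ s : Refl W, commutatorCoeff W y x s • act _ b (s : E ≃ₗᵢ[ℝ] E) f := by
  have hs : ∀ s : Refl W, (param W s * algebraMap ℝ (ParamField W) (inner ℝ y (root s))) •
      (C (algebraMap ℝ (ParamField W) (corootPairing (root s) x)) *
          act _ b (reflectionIn (root s)) f) =
      commutatorCoeff W y x s • act _ b (s : E ≃ₗᵢ[ℝ] E) f := fun s => by
    rw [eq_reflectionIn_root s, C_mul', smul_smul, commutatorCoeff, map_mul, mul_assoc]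
  rw [dunklOp_apply, dunklOp_apply, dirDeriv_mul, dirDeriv_linForm, mul_comm f, C_mul']
  simp only [dividedDiff_linForm_mul, smul_add, Finset.sum_add_distrib, mul_sub, Finset.mul_sum,
    mul_smul_comm, hs]
  abel

variable [Finite W]

theorem dunklOp_mem_lowering (y : E) : dunklOp b W y ∈ lowering (Fin ℓ) (ParamField W) 1 := by
  have := Fintype.ofFinite (Refl W)
  rw [dunklOp_eq_sub_sum, dirDeriv_eq_sum_pderiv]
  exact sub_mem
    (sum_mem fun i _ => Submodule.smul_mem _ _ (pderiv_mem_lowering i))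
    (sum_mem fun s _ => Submodule.smul_mem _ _ (dividedDiff_mem_lowering _ b (root_ne_zero s)))

theorem dunklOp_C (y : E) (r : ParamField W) : dunklOp b W y (C r) = 0 :=
  (dunklOp_mem_lowering b W y).2 0 one_pos _ (isHomogeneous_C _ r)

theorem dunklOp_add_apply (y z : E) (f : Sc ℓ W) :
    dunklOp b W (y + z) f = dunklOp b W y f + dunklOp b W z f := by
  have := Fintype.ofFinite (Refl W)
  simp only [dunklOp_apply, dirDeriv_eq_sum_pderiv, LinearMap.sum_apply, LinearMap.smul_apply,
    inner_add_left, map_add, mul_add, add_smul, Finset.sum_add_distrib,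
    LinearMap.add_apply]
  rw [add_sub_add_comm]

theorem dunklOp_smul_apply (r : ℝ) (y : E) (f : Sc ℓ W) :
    dunklOp b W (r • y) f = algebraMap ℝ (ParamField W) r • dunklOp b W y f := by
  have := Fintype.ofFinite (Refl W)
  simp only [dunklOp_apply, dirDeriv_eq_sum_pderiv, LinearMap.sum_apply, LinearMap.smul_apply,
    real_inner_smul_left, map_mul, smul_sub, Finset.smul_sum, smul_smul,
    mul_left_comm (param W _)]

theorem act_dunklOp (w : W) (y : E) (f : Sc ℓ W) :
    act _ b (w : E ≃ₗᵢ[ℝ] E) (dunklOp b W y f) =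
      dunklOp b W ((w : E ≃ₗᵢ[ℝ] E) y) (act _ b (w : E ≃ₗᵢ[ℝ] E) f) := by
  have := Fintype.ofFinite (Refl W)
  rw [dunklOp_apply, dunklOp_apply, map_sub, act_dirDeriv, map_sum]
  congr 1
  refine Fintype.sum_equiv (conjRefl W w) _ _ fun s => ?_
  have hws : (w : E ≃ₗᵢ[ℝ] E) (root s) ≠ 0 := by simpa using root_ne_zero s
  have hrefl := reflectionIn_root_conjRefl W w s
  obtain ⟨r, hr⟩ := exists_eq_smul_of_reflectionIn_eq (root_ne_zero (conjRefl W w s)) hrefl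
  have hinner : (inner ℝ ((w : E ≃ₗᵢ[ℝ] E) y) (root (conjRefl W w s)) : ℝ) =
      r * inner ℝ y (root s) := by
    rw [hr, real_inner_smul_right, (w : E ≃ₗᵢ[ℝ] E).inner_map_map]
  rw [map_smul, act_dividedDiff _ b _ (root_ne_zero s) hws, param_conjRefl,
    ← smul_dividedDiff_of_eq_smul _ b (root_ne_zero (conjRefl W w s)) hws hrefl hr, smul_smul,
    hinner, map_mul, mul_assoc, mul_comm (algebraMap ℝ (ParamField W) r)]

theorem act_dunklOp_refl (s : Refl W) (y : E) (f : Sc ℓ W) :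
    act _ b (s : E ≃ₗᵢ[ℝ] E) (dunklOp b W y f) =
      dunklOp b W y (act _ b (s : E ≃ₗᵢ[ℝ] E) f) -
        algebraMap ℝ (ParamField W) (corootPairing (root s) y) •
          dunklOp b W (root s) (act _ b (s : E ≃ₗᵢ[ℝ] E) f) := by
  have hsy : (s : E ≃ₗᵢ[ℝ] E) y = y - corootPairing (root s) y • root s := by
    rw [eq_reflectionIn_root s, reflectionIn_apply]
  rw [act_dunklOp b W s.1, hsy, sub_eq_add_neg, ← neg_smul, dunklOp_add_apply, dunklOp_smul_apply,
    map_neg, neg_smul, ← sub_eq_add_neg]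

theorem dunklOp_dunklOp_linForm_mul_sub (y z x : E) (f : Sc ℓ W) :
    dunklOp b W y (dunklOp b W z (linForm _ b x * f)) -
        dunklOp b W z (dunklOp b W y (linForm _ b x * f)) =
      linForm _ b x * (dunklOp b W y (dunklOp b W z f) - dunklOp b W z (dunklOp b W y f)) := by
  have := Fintype.ofFinite (Refl W)
  simp only [dunklOp_linForm_mul, map_add, map_sub, map_sum, map_smul, act_dunklOp_refl, smul_sub,
    smul_smul, Finset.sum_sub_distrib, commutatorCoeff_mul_corootPairing_comm W y z, mul_sub]
  abel

theorem dunklOp_comm_apply (y z : E) (f : Sc ℓ W) :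
    dunklOp b W y (dunklOp b W z f) = dunklOp b W z (dunklOp b W y f) := by
  induction f using MvPolynomial.induction_on with
  | C r => simp [dunklOp_C]
  | add p q hp hq => simp only [map_add, hp, hq]
  | mul_X p j hp =>
    have h := dunklOp_dunklOp_linForm_mul_sub b W y z (b j) p
    rwa [hp, sub_self, mul_zero, linForm_basis, mul_comm, sub_eq_zero] at h

end DunklOperator

section DunklPolynomial

variable (b : OrthonormalBasis (Fin ℓ) ℝ E) (W : Subgroup (E ≃ₗᵢ[ℝ] E)) [Finite W]

theorem dunklOp_commute (y z : E) : Commute (dunklOp b W y) (dunklOp b W z) :=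
  LinearMap.ext (dunklOp_comm_apply b W y z)

/-- The algebra homomorphism `p ↦ ∇_p`. -/
def dunklHom : Sc ℓ W →ₐ[ParamField W] Module.End (ParamField W) (Sc ℓ W) :=
  evalCommuting (fun i => dunklOp b W (b i)) fun i j => dunklOp_commute b W (b i) (b j)

theorem dunklHom_apply (p : Sc ℓ W) : dunklHom b W p = dunklPoly b W p :=
  evalCommuting_eq_sum _ _ p

theorem dunklHom_X (i : Fin ℓ) : dunklHom b W (X i) = dunklOp b W (b i) :=
  evalCommuting_X _ _ i

theorem dunklHom_linForm (v : E) : dunklHom b W (linForm _ b v) = dunklOp b W v := by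
  refine LinearMap.ext fun f => ?_
  have hsum (v : Fin ℓ → E) : dunklOp b W (∑ i, v i) f = ∑ i, dunklOp b W (v i) f :=
    map_sum (AddMonoidHom.mk' (dunklOp b W · f) (dunklOp_add_apply b W · · f)) v _
  conv_rhs => rw [← b.sum_repr v, hsum]
  simp only [linForm, map_sum, C_mul', map_smul, dunklHom_X, b.repr_apply_apply,
    dunklOp_smul_apply, LinearMap.sum_apply, LinearMap.smul_apply]

theorem dunklPoly_mem_lowering {d : ℕ} {p : Sc ℓ W} (hp : p.IsHomogeneous d) :
    dunklPoly b W p ∈ lowering (Fin ℓ) (ParamField W) d := by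
  rw [← dunklHom_apply]
  exact evalCommuting_mem_lowering _ (fun i => dunklOp_mem_lowering b W (b i)) hp

/-- The form `(f, g)_c` as a bilinear form. -/
def dunklBilin : LinearMap.BilinForm (ParamField W) (Sc ℓ W) :=
  (dunklHom b W).toLinearMap.compr₂ (lcoeff (ParamField W) 0)

theorem dunklBilin_apply (f g : Sc ℓ W) : dunklBilin b W f g = dunklForm b W f g := by
  rw [dunklForm, ← dunklHom_apply]
  rfl

theorem dunklForm_mul_left (p q f : Sc ℓ W) :
    dunklForm b W (p * q) f = dunklForm b W p (dunklPoly b W q f) := by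
  simp only [dunklForm, ← dunklHom_apply, map_mul, Module.End.mul_apply]

theorem dunklForm_eq_zero_of_degree_ne {m n : ℕ} {p f : Sc ℓ W} (hp : p.IsHomogeneous m)
    (hf : f.IsHomogeneous n) (h : m ≠ n) : dunklForm b W p f = 0 :=
  constantCoeff_apply_eq_zero_of_mem_lowering (dunklPoly_mem_lowering b W hp) hf h

theorem act_dunklPoly (w : W) (p f : Sc ℓ W) :
    act _ b (w : E ≃ₗᵢ[ℝ] E) (dunklPoly b W p f) =
      dunklPoly b W (act _ b (w : E ≃ₗᵢ[ℝ] E) p) (act _ b (w : E ≃ₗᵢ[ℝ] E) f) := by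
  simp only [← dunklHom_apply]
  induction p using MvPolynomial.induction_on generalizing f with
  | C r => rw [act_C, ← MvPolynomial.algebraMap_eq, AlgHom.commutes, Module.algebraMap_end_apply,
      Module.algebraMap_end_apply, map_smul]
  | add p q hp hq => simp only [map_add, LinearMap.add_apply, hp, hq]
  | mul_X p j hp =>
    simp only [map_mul, Module.End.mul_apply, act_X, dunklHom_X, dunklHom_linForm, hp,
      act_dunklOp]

theorem dunklPoly_mem_invariants {p f : Sc ℓ W} (hp : p ∈ invariants (ParamField W) b W)
    (hf : f ∈ invariants (ParamField W) b W) :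
    dunklPoly b W p f ∈ invariants (ParamField W) b W := fun w hw => by
  rw [act_dunklPoly b W ⟨w, hw⟩, hp w hw, hf w hw]

end DunklPolynomial

section Gram

open Matrix

variable {K M ι : Type*} [Field K] [AddCommGroup M] [Module K M] [Fintype ι]
  (B : LinearMap.BilinForm K M) {v : ι → M}

theorem gram_mulVec (x : ι → K) (i : ι) :
    (of fun i j => B (v i) (v j)).mulVec x i = B (v i) (∑ j, x j • v j) := by
  simp only [mulVec, dotProduct, of_apply, map_sum, map_smul, smul_eq_mul, mul_comm]

variable [DecidableEq ι]

theorem det_gram_ne_zero (hv : LinearIndependent K v)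
    (h : ∀ g ∈ Submodule.span K (Set.range v), (∀ i, B (v i) g = 0) → g = 0) :
    (of fun i j => B (v i) (v j)).det ≠ 0 := by
  intro hdet
  obtain ⟨x, hx, hBx⟩ := exists_mulVec_eq_zero_iff.mpr hdet
  refine hx (funext (Fintype.linearIndependent_iff.mp hv x (h _ ?_ fun i => ?_)))
  · exact sum_mem fun i _ => Submodule.smul_mem _ _ (Submodule.subset_span ⟨i, rfl⟩)
  · rw [← gram_mulVec, hBx, Pi.zero_apply]

theorem eq_zero_of_det_gram_ne_zero (hdet : (of fun i j => B (v i) (v j)).det ≠ 0) {g : M}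
    (hg : g ∈ Submodule.span K (Set.range v)) (h : ∀ i, B (v i) g = 0) : g = 0 := by
  obtain ⟨x, rfl⟩ := (Submodule.mem_span_range_iff_exists_fun _).mp hg
  have hx : x = 0 := eq_zero_of_mulVec_eq_zero hdet (funext fun i => by
    rw [gram_mulVec, h, Pi.zero_apply])
  simp [hx]

theorem exists_orthogonal_sub_of_det_gram_ne_zero
    (hdet : (of fun i j => B (v i) (v j)).det ≠ 0) (g : M) :
    ∃ x ∈ Submodule.span K (Set.range v), ∀ i, B (v i) (g - x) = 0 := by
  refine ⟨∑ j, ((of fun i j => B (v i) (v j))⁻¹.mulVec fun i => B (v i) g) j • v j,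
    sum_mem fun j _ => Submodule.smul_mem _ _ (Submodule.subset_span ⟨j, rfl⟩), fun i => ?_⟩
  rw [map_sub, ← gram_mulVec, mulVec_mulVec, mul_nonsing_inv _ hdet.isUnit, one_mulVec, sub_self]

end Gram

section ScalarExtension

variable {k k' : Type*} [CommRing k] [CommRing k'] [Algebra ℝ k] [Algebra ℝ k']
  (b : OrthonormalBasis (Fin ℓ) ℝ E) (W : Subgroup (E ≃ₗᵢ[ℝ] E))

theorem map_linForm (φ : k →ₐ[ℝ] k') (v : E) :
    map (φ : k →+* k') (linForm k b v) = linForm k' b v := by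
  simp [linForm]

theorem map_act (φ : k →ₐ[ℝ] k') (w : E ≃ₗᵢ[ℝ] E) (f : MvPolynomial (Fin ℓ) k) :
    map (φ : k →+* k') (act k b w f) = act k' b w (map (φ : k →+* k') f) := by
  induction f using MvPolynomial.induction_on with
  | C r => simp [act]
  | add p q hp hq => simp only [map_add, hp, hq]
  | mul_X p j hp =>
    simp only [map_mul, hp]
    simp only [act, aeval_X, map_X, map_linForm]

variable {b W} in
theorem map_mem_invariants (φ : k →ₐ[ℝ] k') {f : MvPolynomial (Fin ℓ) k}
    (hf : f ∈ invariants k b W) : map (φ : k →+* k') f ∈ invariants k' b W := fun w hw => by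
  rw [← map_act, hf w hw]

theorem algebraMap_C (z : ℂ) :
    algebraMap (MvPolynomial (ReflClass W) ℂ) (ParamField W) (C z) =
      algebraMap ℂ (ParamField W) z :=
  (IsScalarTower.algebraMap_apply ℂ (MvPolynomial (ReflClass W) ℂ) (ParamField W) z).symm

theorem toSc_C (z : ℂ) : toSc ℓ W (C z) = C (algebraMap ℂ (ParamField W) z) :=
  map_C _ _

theorem toSc_X (i : Fin ℓ) : toSc ℓ W (X i) = X i := map_X _ _

theorem toSc_linForm (v : E) : toSc ℓ W (linForm ℂ b v) = linForm (ParamField W) b v :=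
  map_linForm b (IsScalarTower.toAlgHom ℝ ℂ (ParamField W)) v

theorem toSc_act (w : E ≃ₗᵢ[ℝ] E) (g : MvPolynomial (Fin ℓ) ℂ) :
    toSc ℓ W (act ℂ b w g) = act (ParamField W) b w (toSc ℓ W g) :=
  map_act b (IsScalarTower.toAlgHom ℝ ℂ (ParamField W)) w g

theorem dividedDiff_toSc {α : E} (hα : α ≠ 0) (g : MvPolynomial (Fin ℓ) ℂ) :
    dividedDiff (ParamField W) b α hα (toSc ℓ W g) = toSc ℓ W (dividedDiff ℂ b α hα g) := by
  refine dividedDiff_eq _ b hα ?_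
  rw [← toSc_linForm, ← map_mul, linForm_mul_dividedDiff, map_sub, toSc_act]

end ScalarExtension

section Specialization

variable (b : OrthonormalBasis (Fin ℓ) ℝ E) {W : Subgroup (E ≃ₗᵢ[ℝ] E)}

/-- `f` has coefficients in `ℂ[c]`, and its value at `c = 0` is `g`. -/
def Specializes (f : Sc ℓ W) (g : MvPolynomial (Fin ℓ) ℂ) : Prop :=
  ∃ F : MvPolynomial (Fin ℓ) (MvPolynomial (ReflClass W) ℂ),
    map (algebraMap _ (ParamField W)) F = f ∧ map constantCoeff F = g

theorem Specializes.add {f f' : Sc ℓ W} {g g' : MvPolynomial (Fin ℓ) ℂ} :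
    Specializes f g → Specializes f' g' → Specializes (f + f') (g + g')
  | ⟨F, hf, hg⟩, ⟨F', hf', hg'⟩ => ⟨F + F', by rw [map_add, hf, hf'], by rw [map_add, hg, hg']⟩

theorem Specializes.smul {f : Sc ℓ W} {g : MvPolynomial (Fin ℓ) ℂ}
    (a : MvPolynomial (ReflClass W) ℂ) :
    Specializes f g → Specializes (algebraMap _ (ParamField W) a • f) (constantCoeff a • g)
  | ⟨F, hf, hg⟩ => ⟨C a * F, by rw [map_mul, map_C, hf, smul_eq_C_mul],
      by rw [map_mul, map_C, hg, smul_eq_C_mul]⟩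

theorem specializes_toSc (g : MvPolynomial (Fin ℓ) ℂ) : Specializes (toSc ℓ W g) g := by
  refine ⟨map C g, ?_, ?_⟩
  · rw [map_map, toSc]
    congr 2
  · rw [map_map]
    convert map_id g
    exact RingHom.ext fun z => constantCoeff_C _ z

variable [Finite W]

theorem specializes_dunklOp_toSc (i : Fin ℓ) (g : MvPolynomial (Fin ℓ) ℂ) :
    Specializes (dunklOp b W (b i) (toSc ℓ W g)) (pderiv i g) := by
  have := Fintype.ofFinite (Refl W)
  suffices h : Specializes (∑ s : Refl W,
      (param W s * algebraMap ℝ (ParamField W) (inner ℝ (b i) (root s))) •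
        dividedDiff (ParamField W) b (root s) (root_ne_zero s) (toSc ℓ W g)) 0 by
    have h' := (specializes_toSc (W := W) (pderiv i g)).add (h.smul (-1))
    simpa [dunklOp_apply, dirDeriv_basis, toSc, pderiv_map, sub_eq_add_neg] using h'
  refine Finset.sum_induction (M := Sc ℓ W) _ (fun f => Specializes f 0)
    (fun f f' h h' => by simpa only [add_zero] using h.add h')
    ⟨0, map_zero _, map_zero _⟩ fun s _ => ?_
  have h := (specializes_toSc (W := W) (dividedDiff ℂ b (root s) (root_ne_zero s) g)).smul
    (X (Quotient.mk _ s) * C (algebraMap ℝ ℂ (inner ℝ (b i) (root s))))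
  rwa [map_mul constantCoeff, constantCoeff_X, zero_mul, zero_smul, map_mul, algebraMap_C,
    ← dividedDiff_toSc, ← IsScalarTower.algebraMap_apply] at h

theorem Specializes.dunklOp {f : Sc ℓ W} {g : MvPolynomial (Fin ℓ) ℂ} (h : Specializes f g)
    (i : Fin ℓ) : Specializes (dunklOp b W (b i) f) (pderiv i g) := by
  obtain ⟨F, rfl, rfl⟩ := h
  induction F using MvPolynomial.induction_on' with
  | monomial m a =>
    have h := (specializes_dunklOp_toSc b (W := W) i (monomial m 1)).smul a
    rwa [← map_smul, ← Derivation.map_smul, toSc, map_monomial, map_one, smul_monomial,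
      smul_monomial, smul_eq_mul, smul_eq_mul, mul_one, mul_one, ← map_monomial,
      ← map_monomial] at h
  | add F F' hF hF' =>
    simp only [map_add]
    exact hF.add hF'

theorem Specializes.dunklHom (p : MvPolynomial (Fin ℓ) ℂ) {f : Sc ℓ W}
    {g : MvPolynomial (Fin ℓ) ℂ} (h : Specializes f g) :
    Specializes (dunklHom b W (toSc ℓ W p) f) (diffPoly (Fin ℓ) ℂ p g) := by
  induction p using MvPolynomial.induction_on generalizing f g with
  | C z =>
    rw [toSc_C, ← MvPolynomial.algebraMap_eq, ← MvPolynomial.algebraMap_eq, AlgHom.commutes,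
      AlgHom.commutes, Module.algebraMap_end_apply, Module.algebraMap_end_apply, ← algebraMap_C]
    simpa only [constantCoeff_C] using h.smul (C z)
  | add p q hp hq =>
    rw [map_add, map_add, map_add]
    exact (hp h).add (hq h)
  | mul_X p j hp =>
    rw [map_mul, map_mul, map_mul, toSc_X, dunklHom_X, Module.End.mul_apply,
      Module.End.mul_apply, diffPoly_X_apply]
    exact hp (h.dunklOp b j)

theorem exists_dunklForm_toSc_eq_algebraMap (p g : MvPolynomial (Fin ℓ) ℂ) :
    ∃ a : MvPolynomial (ReflClass W) ℂ,
      dunklForm b W (toSc ℓ W p) (toSc ℓ W g) = algebraMap _ (ParamField W) a ∧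
        constantCoeff a = constantCoeff (diffPoly (Fin ℓ) ℂ p g) := by
  obtain ⟨F, h1, h2⟩ := (specializes_toSc (W := W) g).dunklHom b p
  refine ⟨constantCoeff F, ?_, ?_⟩
  · rw [dunklForm, ← dunklHom_apply, ← h1, constantCoeff_map]
  · rw [← h2, constantCoeff_map]

end Specialization

section Nondegeneracy

variable {W : Subgroup (E ≃ₗᵢ[ℝ] E)} {ι : Type*} {v : ι → MvPolynomial (Fin ℓ) ℂ}

/-- The pairing of `p` and `g` given by the constant term of `p(∂) g`. -/
def fischerBilin (σ : Type*) : LinearMap.BilinForm ℂ (MvPolynomial σ ℂ) :=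
  (diffPoly σ ℂ).toLinearMap.compr₂ (lcoeff ℂ 0)

theorem eq_zero_of_fischerBilin_eq_zero {σ : Type*} {v : ι → MvPolynomial σ ℂ}
    (hconj : ∀ i, conjPoly σ (v i) ∈ Submodule.span ℂ (Set.range v)) {g : MvPolynomial σ ℂ}
    (hg : g ∈ Submodule.span ℂ (Set.range v)) (h : ∀ i, fischerBilin σ (v i) g = 0) :
    g = 0 := by
  have hspan : Submodule.span ℂ (Set.range v) ≤ LinearMap.ker ((fischerBilin σ).flip g) :=
    Submodule.span_le.mpr (Set.range_subset_iff.mpr h)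
  have hconj' : ∀ f ∈ Submodule.span ℂ (Set.range v),
      conjPoly σ f ∈ Submodule.span ℂ (Set.range v) := by
    intro f hf
    induction hf using Submodule.span_induction with
    | mem x hx => obtain ⟨i, rfl⟩ := hx; exact hconj i
    | zero => rw [map_zero]; exact zero_mem _
    | add x y _ _ hx hy => rw [map_add]; exact add_mem hx hy
    | smul z x _ hx => rw [conjPoly_smul]; exact Submodule.smul_mem _ _ hx
  by_contra hg0
  exact constantCoeff_diffPoly_conjPoly_ne_zero hg0 (hspan (hconj' g hg))

variable (b : OrthonormalBasis (Fin ℓ) ℝ E) [Finite W]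

theorem det_dunklForm_toSc_ne_zero [Fintype ι] [DecidableEq ι] (hv : LinearIndependent ℂ v)
    (hconj : ∀ i, conjPoly (Fin ℓ) (v i) ∈ Submodule.span ℂ (Set.range v)) :
    (Matrix.of fun i j => dunklBilin b W (toSc ℓ W (v i)) (toSc ℓ W (v j))).det ≠ 0 := by
  choose a ha ha0 using fun i j => exists_dunklForm_toSc_eq_algebraMap b (W := W) (v i) (v j)
  have hgram : (Matrix.of fun i j => dunklBilin b W (toSc ℓ W (v i)) (toSc ℓ W (v j))) =
      (algebraMap _ (ParamField W)).mapMatrix (Matrix.of a) :=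
    Matrix.ext fun i j => (dunklBilin_apply b W _ _).trans (ha i j)
  have hgram0 : constantCoeff.mapMatrix (Matrix.of a) =
      Matrix.of fun i j => fischerBilin (Fin ℓ) (v i) (v j) := Matrix.ext ha0
  rw [hgram, ← RingHom.map_det, map_ne_zero_iff _ (IsFractionRing.injective _ _)]
  refine ne_zero_of_map (f := (constantCoeff : MvPolynomial (ReflClass W) ℂ →+* ℂ)) ?_
  rw [RingHom.map_det, hgram0]
  exact det_gram_ne_zero _ hv fun g => eq_zero_of_fischerBilin_eq_zero hconj

theorem eq_zero_of_dunklForm_toSc_eq_zero [Finite ι] (hv : LinearIndependent ℂ v)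
    (hconj : ∀ i, conjPoly (Fin ℓ) (v i) ∈ Submodule.span ℂ (Set.range v)) {g : Sc ℓ W}
    (hg : g ∈ Submodule.span (ParamField W) (Set.range fun i => toSc ℓ W (v i)))
    (h : ∀ i, dunklForm b W (toSc ℓ W (v i)) g = 0) : g = 0 := by
  classical
  have := Fintype.ofFinite ι
  refine eq_zero_of_det_gram_ne_zero _ (det_dunklForm_toSc_ne_zero b hv hconj) hg fun i => ?_
  rw [dunklBilin_apply, h]

theorem exists_dunklForm_toSc_sub_eq_zero [Finite ι] (hv : LinearIndependent ℂ v)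
    (hconj : ∀ i, conjPoly (Fin ℓ) (v i) ∈ Submodule.span ℂ (Set.range v)) (g : Sc ℓ W) :
    ∃ x ∈ Submodule.span (ParamField W) (Set.range fun i => toSc ℓ W (v i)),
      ∀ i, dunklForm b W (toSc ℓ W (v i)) (g - x) = 0 := by
  classical
  have := Fintype.ofFinite ι
  simpa only [dunklBilin_apply] using exists_orthogonal_sub_of_det_gram_ne_zero
    (dunklBilin b W) (det_dunklForm_toSc_ne_zero b hv hconj) g

end Nondegeneracy

section Exponents

variable {r : ℕ} {a a' : Fin r → ℕ}

theorem prec_iff_toColex_lt : Prec a' a ↔ toColex a' < toColex a :=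
  exists_congr fun _ => and_comm

theorem Prec.trans {a'' : Fin r → ℕ} (h : Prec a'' a') (h' : Prec a' a) : Prec a'' a :=
  prec_iff_toColex_lt.mpr ((prec_iff_toColex_lt.mp h).trans (prec_iff_toColex_lt.mp h'))

theorem not_prec_self (a : Fin r → ℕ) : ¬ Prec a a := fun h =>
  lt_irrefl _ (prec_iff_toColex_lt.mp h)

theorem Prec.add_right (h : Prec a' a) (c : Fin r → ℕ) : Prec (a' + c) (a + c) :=
  h.imp fun _ hi => ⟨Nat.add_lt_add_right hi.1 _, fun j hj => congrArg (· + c j) (hi.2 j hj)⟩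

theorem prec_single_iff {k : Fin r} {n : ℕ} :
    Prec a (Pi.single k n) ↔ a k < n ∧ ∀ j, k < j → a j = 0 := by
  constructor
  · rintro ⟨i, hi, hi'⟩
    obtain rfl : i = k := by
      by_contra h
      simp [Pi.single_eq_of_ne h] at hi
    exact ⟨by simpa using hi, fun j hj => by simpa [hj.ne'] using hi' j hj⟩
  · exact fun ⟨hk, h⟩ => ⟨k, by simpa using hk, fun j hj => by simpa [hj.ne'] using h j hj⟩

variable {d : Fin r → ℕ}

theorem mul_le_dotProduct (d a : Fin r → ℕ) (i : Fin r) : d i * a i ≤ d ⬝ᵥ a :=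
  Finset.single_le_sum (f := fun i => d i * a i) (fun _ _ => Nat.zero_le _) (Finset.mem_univ i)

theorem finite_dotProduct_le (hd : ∀ i, 0 < d i) (n : ℕ) :
    {a : Fin r → ℕ | d ⬝ᵥ a ≤ n}.Finite :=
  (Set.finite_Iic fun _ => n).subset fun a ha i =>
    (Nat.le_mul_of_pos_left _ (hd i)).trans ((mul_le_dotProduct d a i).trans ha)

theorem eq_single_of_le_apply (hd : ∀ i, 0 < d i) {k : Fin r} {n : ℕ}
    (ha : d ⬝ᵥ a = d k * n) (hn : n ≤ a k) : a = Pi.single k n := by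
  have hle : Pi.single k n ≤ a := fun i => by
    rcases eq_or_ne i k with rfl | hi
    · rwa [Pi.single_eq_same]
    · simp [hi]
  obtain ⟨c, rfl⟩ := exists_add_of_le hle
  rw [dotProduct_add, dotProduct_single] at ha
  have hc : c = 0 := funext fun i => by
    have hi := mul_le_dotProduct d c i
    exact (Nat.mul_eq_zero.mp (by omega : d i * c i = 0)).resolve_left (hd i).ne'
  rw [hc, add_zero]

theorem dotProduct_eq_zero_of_add_eq_single {k : Fin r} {n : ℕ} (h : a' + a = Pi.single k n)
    (ha : d ⬝ᵥ a < d k) : d ⬝ᵥ a = 0 := by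
  have hne : ∀ i ≠ k, a i = 0 := fun i hi => by
    have := congrFun h i
    simp only [Pi.add_apply, Pi.single_eq_of_ne hi] at this
    omega
  have hsingle : a = Pi.single k (a k) := funext fun i => by
    rcases eq_or_ne i k with rfl | hi
    · rw [Pi.single_eq_same]
    · rw [hne i hi, Pi.single_eq_of_ne hi]
  rw [hsingle, dotProduct_single] at ha ⊢
  rw [Nat.lt_one_iff.mp (Nat.lt_of_mul_lt_mul_left (ha.trans_eq (mul_one _).symm)), mul_zero]

/-- The exponents that precede `a` and have the same weighted degree, for the weights `d`. -/
def lowerExponents (d a : Fin r → ℕ) : Set (Fin r → ℕ) := {a' | Prec a' a ∧ d ⬝ᵥ a' = d ⬝ᵥ a}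

theorem finite_lowerExponents (hd : ∀ i, 0 < d i) (a : Fin r → ℕ) : (lowerExponents d a).Finite :=
  (finite_dotProduct_le hd _).subset fun _ h => h.2.le

theorem exists_lt_ne_zero_of_mem_lowerExponents_single (hd : ∀ i, 0 < d i) {k : Fin r} {n : ℕ}
    (ha : a ∈ lowerExponents d (Pi.single k n)) : ∃ i < k, a i ≠ 0 := by
  obtain ⟨hprec, hdeg⟩ := ha
  obtain ⟨hk, hgt⟩ := prec_single_iff.mp hprec
  by_contra! hlt
  rw [dotProduct_single, dotProduct, Finset.sum_eq_single k] at hdeg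
  · exact hk.ne (Nat.eq_of_mul_eq_mul_left (hd k) hdeg)
  · intro i _ hi
    rcases lt_or_gt_of_ne hi with h | h
    · rw [hlt i h, mul_zero]
    · rw [hgt i h, mul_zero]
  · exact fun h => absurd (Finset.mem_univ k) h

/-- `a` is the largest exponent of its weighted degree, for the weights `d`. -/
def IsLargestExponent (d a : Fin r → ℕ) : Prop := ∀ a', d ⬝ᵥ a' = d ⬝ᵥ a → a' = a ∨ Prec a' a

theorem isLargestExponent_single (hd : ∀ i, 0 < d i) {k : Fin r} {n : ℕ}
    (h : ∀ a, d ⬝ᵥ a = d k * n → ∀ j, k < j → a j = 0) : IsLargestExponent d (Pi.single k n) := by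
  intro a ha
  rw [dotProduct_single] at ha
  rcases lt_or_ge (a k) n with hlt | hle
  · exact Or.inr (prec_single_iff.mpr ⟨hlt, h a ha⟩)
  · exact Or.inl (eq_single_of_le_apply hd ha hle)

theorem isLargestExponent_single_one (hd : ∀ i, 0 < d i) (hmono : StrictMono d) (k : Fin r) :
    IsLargestExponent d (Pi.single k 1) := by
  refine isLargestExponent_single hd fun a ha j hj => ?_
  by_contra h0
  have hle := (Nat.le_mul_of_pos_right _ (Nat.pos_of_ne_zero h0)).trans (mul_le_dotProduct d a j)
  exact (hmono hj).not_ge (by rwa [ha, mul_one] at hle)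

theorem isLargestExponent_single_last (hd : ∀ i, 0 < d i) {m : Fin r} (hm : ∀ j, j ≤ m) (n : ℕ) :
    IsLargestExponent d (Pi.single m n) :=
  isLargestExponent_single hd fun _ _ j hj => absurd (hm j) hj.not_ge

end Exponents

section TriangularSpans

variable {r : ℕ}

/-- The monomial `u^a` in the elements `u i`. -/
def powProd {R : Type*} [CommMonoid R] (u : Fin r → R) (a : Fin r → ℕ) : R := ∏ i, u i ^ a i

section CommMonoid

variable {R : Type*} [CommMonoid R]

theorem powProd_zero (u : Fin r → R) : powProd u 0 = 1 := by simp [powProd]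

theorem powProd_add (u : Fin r → R) (a c : Fin r → ℕ) :
    powProd u (a + c) = powProd u a * powProd u c := by
  simp [powProd, pow_add, Finset.prod_mul_distrib]

theorem powProd_single (u : Fin r → R) (i : Fin r) (n : ℕ) :
    powProd u (Pi.single i n) = u i ^ n := by
  rw [powProd, Finset.prod_eq_single i (fun j _ hj => by rw [Pi.single_eq_of_ne hj, pow_zero])
    fun h => absurd (Finset.mem_univ i) h, Pi.single_eq_same]

theorem map_powProd {R' : Type*} [CommMonoid R'] (f : R →* R') (u : Fin r → R) (a : Fin r → ℕ) :
    f (powProd u a) = powProd (f ∘ u) a := by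
  simp [powProd]

end CommMonoid

variable (k : Type*) {R : Type*} [CommRing k] [CommRing R] [Algebra k R] {d : Fin r → ℕ}
  {u v : Fin r → R}

/-- The span of the monomials `u^a'` of the same weighted degree as `u^a` with `a' ≺ a`. -/
def lowerSpan (u : Fin r → R) (d a : Fin r → ℕ) : Submodule k R :=
  Submodule.span k (powProd u '' lowerExponents d a)

/-- The span of `u^a` and of the monomials `u^a'` of the same weighted degree with `a' ≺ a`. -/
def leadSpan (u : Fin r → R) (d a : Fin r → ℕ) : Submodule k R :=
  Submodule.span k (powProd u '' insert a (lowerExponents d a))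

variable {k}

theorem mem_leadSpan_iff {a : Fin r → ℕ} {x : R} :
    x ∈ leadSpan k u d a ↔ ∃ z : k, x - z • powProd u a ∈ lowerSpan k u d a := by
  rw [leadSpan, Set.image_insert_eq, Submodule.mem_span_insert]
  constructor
  · rintro ⟨z, y, hy, rfl⟩
    exact ⟨z, by rwa [add_sub_cancel_left]⟩
  · exact fun ⟨z, hz⟩ => ⟨z, _, hz, (add_sub_cancel _ _).symm⟩

theorem leadSpan_le_lowerSpan {a a' : Fin r → ℕ} (h : a' ∈ lowerExponents d a) :
    leadSpan k u d a' ≤ lowerSpan k u d a := by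
  refine Submodule.span_mono (Set.image_mono (Set.insert_subset h ?_))
  exact fun a'' h' => ⟨h'.1.trans h.1, h'.2.trans h.2⟩

theorem add_mem_insert_lowerExponents {a a' c c' : Fin r → ℕ}
    (ha : a' ∈ insert a (lowerExponents d a)) (hc : c' ∈ insert c (lowerExponents d c)) :
    a' + c' ∈ insert (a + c) (lowerExponents d (a + c)) := by
  have hright : ∀ {a a' : Fin r → ℕ} (c), a' ∈ lowerExponents d a →
      a' + c ∈ lowerExponents d (a + c) := fun c h =>
    ⟨h.1.add_right c, by rw [dotProduct_add, dotProduct_add, h.2]⟩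
  have hleft : c' ∈ lowerExponents d c → a + c' ∈ lowerExponents d (a + c) := fun h => by
    simpa only [add_comm a] using hright a h
  rcases ha with rfl | ha <;> rcases hc with rfl | hc
  · exact Or.inl rfl
  · exact Or.inr (hleft hc)
  · exact Or.inr (hright _ ha)
  · have hadd := hright c' ha
    have hc' := hleft hc
    exact Or.inr ⟨hadd.1.trans hc'.1, hadd.2.trans hc'.2⟩

instance leadSpan.gradedMonoid (u : Fin r → R) (d : Fin r → ℕ) :
    SetLike.GradedMonoid (leadSpan k u d) where
  one_mem := Submodule.subset_span ⟨0, Or.inl rfl, powProd_zero u⟩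
  mul_mem a c x y hx hy := by
    have hxy := Submodule.mul_mem_mul hx hy
    rw [leadSpan, leadSpan, Submodule.span_mul_span] at hxy
    refine Submodule.span_mono ?_ hxy
    rintro _ ⟨_, ⟨a', ha, rfl⟩, _, ⟨c', hc, rfl⟩, rfl⟩
    exact ⟨a' + c', add_mem_insert_lowerExponents ha hc, powProd_add u a' c'⟩

theorem powProd_mem_leadSpan (hv : ∀ i, v i ∈ leadSpan k u d (Pi.single i 1)) (a : Fin r → ℕ) :
    powProd v a ∈ leadSpan k u d a := by
  have h := SetLike.prod_mem_graded (leadSpan k u d) (fun i => a i • Pi.single i 1)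
    (fun i => v i ^ a i) (F := Finset.univ) fun i _ => SetLike.pow_mem_graded (a i) (hv i)
  simp only [← Pi.single_smul, smul_eq_mul, mul_one, Finset.univ_sum_single] at h
  exact h

theorem powProd_mem_lowerSpan (hv : ∀ i, v i ∈ leadSpan k u d (Pi.single i 1))
    {a a' : Fin r → ℕ} (h : a' ∈ lowerExponents d a) : powProd v a' ∈ lowerSpan k u d a :=
  leadSpan_le_lowerSpan h (powProd_mem_leadSpan hv a')

theorem lowerSpan_le_lowerSpan (hv : ∀ i, v i ∈ leadSpan k u d (Pi.single i 1))
    (a : Fin r → ℕ) : lowerSpan k v d a ≤ lowerSpan k u d a := by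
  rw [lowerSpan, Submodule.span_le]
  rintro _ ⟨a', h, rfl⟩
  exact powProd_mem_lowerSpan hv h

theorem mem_of_triangular {A : Subalgebra k R} {z : Fin r → kˣ} {e : Fin r → R}
    (he : ∀ i, e i ∈ A) (h : ∀ i, e i - z i • u i ∈ lowerSpan k u d (Pi.single i 1)) (i : Fin r) :
    u i ∈ A := by
  induction i using WellFoundedLT.induction with
  | _ i ih =>
    have hle : lowerSpan k u d (Pi.single i 1) ≤ Subalgebra.toSubmodule A := by
      rw [lowerSpan, Submodule.span_le]
      rintro _ ⟨a, ha, rfl⟩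
      obtain ⟨hi, hgt⟩ := prec_single_iff.mp ha.1
      change ∏ j, u j ^ a j ∈ A
      refine prod_mem fun j _ => ?_
      rcases lt_trichotomy j i with hj | rfl | hj
      · exact pow_mem (ih j hj) _
      · rw [Nat.lt_one_iff.mp hi, pow_zero]
        exact one_mem A
      · rw [hgt j hj, pow_zero]
        exact one_mem A
    have hzu : z i • u i ∈ Subalgebra.toSubmodule A := by
      simpa using sub_mem (show e i ∈ Subalgebra.toSubmodule A from he i) (hle (h i))
    exact (Submodule.smul_mem_iff' _ (z i)).mp hzu

end TriangularSpans

section HomogeneousGenerators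

variable {k σ : Type*} [CommRing k] {r : ℕ} {d : Fin r → ℕ} {u v : Fin r → MvPolynomial σ k}

theorem powProd_isHomogeneous (hu : ∀ i, (u i).IsHomogeneous (d i)) (a : Fin r → ℕ) :
    (powProd u a).IsHomogeneous (d ⬝ᵥ a) :=
  IsHomogeneous.prod _ _ _ fun i _ => (hu i).pow (a i)

theorem isHomogeneous_of_mem_lowerSpan (hu : ∀ i, (u i).IsHomogeneous (d i)) {a : Fin r → ℕ}
    {f : MvPolynomial σ k} (hf : f ∈ lowerSpan k u d a) : f.IsHomogeneous (d ⬝ᵥ a) := by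
  have hle : lowerSpan k u d a ≤ homogeneousSubmodule σ k (d ⬝ᵥ a) := by
    rw [lowerSpan, Submodule.span_le]
    rintro _ ⟨a', ha', rfl⟩
    exact ha'.2 ▸ powProd_isHomogeneous hu a'
  exact hle hf

theorem powProd_eq_aeval_monomial (u : Fin r → MvPolynomial σ k) (m : Fin r →₀ ℕ) :
    powProd u m = aeval u (monomial m (1 : k)) := by
  rw [aeval_monomial, map_one, one_mul, Finsupp.prod_fintype _ _ fun i => pow_zero _, powProd]

theorem linearIndependent_powProd (hu : AlgebraicIndependent k u) :
    LinearIndependent k (powProd u) := by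
  have h := ((basisMonomials (Fin r) k).linearIndependent.map' (aeval u).toLinearMap
    (LinearMap.ker_eq_bot.mpr hu)).comp _ Finsupp.equivFunOnFinite.symm.injective
  have hu' : powProd u = (aeval u).toLinearMap ∘ basisMonomials (Fin r) k ∘
      Finsupp.equivFunOnFinite.symm := funext fun a => by
    simpa using powProd_eq_aeval_monomial u (Finsupp.equivFunOnFinite.symm a)
  rw [hu']
  exact h

theorem span_range_powProd (u : Fin r → MvPolynomial σ k) :
    Submodule.span k (Set.range (powProd u)) =
      Subalgebra.toSubmodule (Algebra.adjoin k (Set.range u)) := by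
  refine le_antisymm (Submodule.span_le.mpr ?_) fun f hf => ?_
  · rintro _ ⟨a, rfl⟩
    change ∏ i, u i ^ a i ∈ Algebra.adjoin k (Set.range u)
    exact prod_mem fun i _ => pow_mem (Algebra.subset_adjoin (Set.mem_range_self i)) (a i)
  · rw [Subalgebra.mem_toSubmodule, Algebra.adjoin_range_eq_range_aeval] at hf
    obtain ⟨p, rfl⟩ := hf
    change aeval u p ∈ _
    induction p using MvPolynomial.induction_on' with
    | monomial m z =>
      rw [← mul_one z, ← smul_eq_mul, ← smul_monomial, map_smul]
      exact Submodule.smul_mem _ _ (Submodule.subset_span ⟨m, powProd_eq_aeval_monomial u m⟩)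
    | add p q hp hq =>
      rw [map_add]
      exact add_mem hp hq

/-- `A` is the algebra of polynomials in the algebraically independent elements `u i`, where
`u i` is homogeneous of degree `d i`: a homogeneous generating set, over any coefficients. -/
structure IsHomogeneousGenerators (A : Subalgebra k (MvPolynomial σ k)) (d : Fin r → ℕ)
    (u : Fin r → MvPolynomial σ k) : Prop where
  isHomogeneous : ∀ i, (u i).IsHomogeneous (d i)
  algebraicIndependent : AlgebraicIndependent k u
  adjoin_eq : Algebra.adjoin k (Set.range u) = A

namespace IsHomogeneousGenerators

variable {A : Subalgebra k (MvPolynomial σ k)}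

theorem mem (hu : IsHomogeneousGenerators A d u) (i : Fin r) : u i ∈ A :=
  hu.adjoin_eq ▸ Algebra.subset_adjoin ⟨i, rfl⟩

theorem powProd_mem (hu : IsHomogeneousGenerators A d u) (a : Fin r → ℕ) : powProd u a ∈ A :=
  prod_mem fun i _ => pow_mem (hu.mem i) (a i)

theorem lowerSpan_le (hu : IsHomogeneousGenerators A d u) (a : Fin r → ℕ) :
    lowerSpan k u d a ≤ Subalgebra.toSubmodule A := by
  rw [lowerSpan, Submodule.span_le]
  rintro _ ⟨a', _, rfl⟩
  exact hu.powProd_mem a'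

theorem homogeneousComponent_mem_span (hu : IsHomogeneousGenerators A d u)
    {f : MvPolynomial σ k} (hf : f ∈ A) (n : ℕ) :
    homogeneousComponent n f ∈ Submodule.span k (powProd u '' {a | d ⬝ᵥ a = n}) := by
  refine Dunkl.homogeneousComponent_mem_span (powProd_isHomogeneous hu.isHomogeneous) ?_ n
  rwa [span_range_powProd, hu.adjoin_eq]

theorem mem_span_of_isHomogeneous (hu : IsHomogeneousGenerators A d u) {f : MvPolynomial σ k}
    (hf : f ∈ A) {n : ℕ} (hn : f.IsHomogeneous n) :
    f ∈ Submodule.span k (powProd u '' {a | d ⬝ᵥ a = n}) :=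
  homogeneousComponent_eq_self hn ▸ hu.homogeneousComponent_mem_span hf n

theorem mem_span_of_homogeneousComponent_ne_zero (hu : IsHomogeneousGenerators A d u)
    {f : MvPolynomial σ k} (hf : f ∈ A) :
    f ∈ Submodule.span k (powProd u '' {a | homogeneousComponent (d ⬝ᵥ a) f ≠ 0}) := by
  suffices h : ∀ n, homogeneousComponent n f ∈
      Submodule.span k (powProd u '' {a | homogeneousComponent (d ⬝ᵥ a) f ≠ 0}) by
    have hsum := sum_mem fun n (_ : n ∈ Finset.range (f.totalDegree + 1)) => h n
    rwa [sum_homogeneousComponent] at hsum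
  intro n
  rcases eq_or_ne (homogeneousComponent n f) 0 with h0 | h0
  · rw [h0]
    exact zero_mem _
  · refine Submodule.span_mono (Set.image_mono ?_) (hu.homogeneousComponent_mem_span hf n)
    rintro a rfl
    exact h0

theorem mem_leadSpan (hu : IsHomogeneousGenerators A d u) {a : Fin r → ℕ}
    (ha : IsLargestExponent d a) {f : MvPolynomial σ k} (hf : f ∈ A)
    (hn : f.IsHomogeneous (d ⬝ᵥ a)) : f ∈ leadSpan k u d a :=
  Submodule.span_mono (Set.image_mono fun a' h => (ha a' h).imp id fun h' => ⟨h', h⟩)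
    (hu.mem_span_of_isHomogeneous hf hn)

variable [Nontrivial k]

theorem degree_pos (hu : IsHomogeneousGenerators A d u) (i : Fin r) : 0 < d i := by
  refine Nat.pos_of_ne_zero fun h0 => hu.algebraicIndependent.transcendental i ?_
  have h := hu.isHomogeneous i
  rw [h0, ← totalDegree_zero_iff_isHomogeneous] at h
  rw [totalDegree_eq_zero_iff_eq_C.mp h]
  exact isAlgebraic_algebraMap _

theorem powProd_notMem_lowerSpan (hu : IsHomogeneousGenerators A d u) (a : Fin r → ℕ) :
    powProd u a ∉ lowerSpan k u d a :=
  (linearIndependent_powProd hu.algebraicIndependent).notMem_span_image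
    fun h => not_prec_self a h.1

theorem constantCoeff_eq_zero (hu : IsHomogeneousGenerators A d u) (i : Fin r) :
    constantCoeff (u i) = 0 := by
  rw [constantCoeff_eq]
  exact (hu.isHomogeneous i).coeff_eq_zero (by simpa using (hu.degree_pos i).ne)

theorem mem_leadSpan_single_one (hu : IsHomogeneousGenerators A d u) (hd : StrictMono d)
    (hv : ∀ i, v i ∈ A) (hv' : ∀ i, (v i).IsHomogeneous (d i)) (i : Fin r) :
    v i ∈ leadSpan k u d (Pi.single i 1) :=
  hu.mem_leadSpan (isLargestExponent_single_one hu.degree_pos hd i) (hv i)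
    (by simpa only [dotProduct_single, mul_one] using hv' i)

theorem lowerSpan_eq (hu : IsHomogeneousGenerators A d u) (hv : IsHomogeneousGenerators A d v)
    (hd : StrictMono d) (a : Fin r → ℕ) : lowerSpan k u d a = lowerSpan k v d a :=
  le_antisymm
    (lowerSpan_le_lowerSpan (hv.mem_leadSpan_single_one hd hu.mem hu.isHomogeneous) a)
    (lowerSpan_le_lowerSpan (hu.mem_leadSpan_single_one hd hv.mem hv.isHomogeneous) a)

theorem exists_sub_smul_mem_lowerSpan (hu : IsHomogeneousGenerators A d u)
    (hv : IsHomogeneousGenerators A d v) (hd : StrictMono d) (a : Fin r → ℕ) :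
    ∃ z : k, z ≠ 0 ∧ powProd u a - z • powProd v a ∈ lowerSpan k v d a := by
  obtain ⟨z, hz⟩ := mem_leadSpan_iff.mp
    (powProd_mem_leadSpan (hv.mem_leadSpan_single_one hd hu.mem hu.isHomogeneous) a)
  refine ⟨z, ?_, hz⟩
  rintro rfl
  rw [zero_smul, sub_zero, ← hu.lowerSpan_eq hv hd] at hz
  exact hu.powProd_notMem_lowerSpan a hz

end IsHomogeneousGenerators

end HomogeneousGenerators

section BaseChange

theorem map_mem_span {σ k : Type*} (K : Type*) [CommRing k] [CommRing K] [Algebra k K]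
    {s : Set (MvPolynomial σ k)} {g : MvPolynomial σ k} (hg : g ∈ Submodule.span k s) :
    map (algebraMap k K) g ∈ Submodule.span K (map (algebraMap k K) '' s) := by
  induction hg using Submodule.span_induction with
  | mem g hg => exact Submodule.subset_span ⟨g, hg, rfl⟩
  | zero => rw [map_zero]; exact zero_mem _
  | add f g _ _ hf hg => rw [map_add]; exact add_mem hf hg
  | smul z f _ hf =>
    rw [smul_eq_C_mul, map_mul, map_C, ← smul_eq_C_mul]
    exact Submodule.smul_mem _ _ hf

theorem algebraicIndependent_map {σ ι k : Type*} (K : Type*) [CommRing k] [CommRing K]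
    [Algebra k K] [Module.Flat k K] {u : ι → MvPolynomial σ k} (hu : AlgebraicIndependent k u) :
    AlgebraicIndependent K fun i => map (algebraMap k K) (u i) := by
  have hcomp : (aeval fun i => map (algebraMap k K) (u i)).comp
        (algebraTensorAlgEquiv k K : _ ≃ₐ[K] MvPolynomial ι K).toAlgHom =
      (algebraTensorAlgEquiv k K : _ ≃ₐ[K] MvPolynomial σ K).toAlgHom.comp
        (Algebra.TensorProduct.map (AlgHom.id K K) (aeval u)) := by
    refine Algebra.TensorProduct.ext (by ext) (algHom_ext fun i => ?_)
    simp
  have hinj := (algebraTensorAlgEquiv k K).injective.comp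
    (Module.Flat.lTensor_preserves_injective_linearMap (M := K) (aeval u).toLinearMap hu)
  have h := hinj.comp (algebraTensorAlgEquiv (σ := ι) k K).symm.injective
  rw [algebraicIndependent_iff_injective_aeval]
  convert h using 1
  funext p
  obtain ⟨t, rfl⟩ := (algebraTensorAlgEquiv k K).surjective p
  simp only [Function.comp_apply, AlgEquiv.symm_apply_apply]
  exact AlgHom.congr_fun hcomp t

end BaseChange

section Invariants

variable {b : OrthonormalBasis (Fin ℓ) ℝ E} {W : Subgroup (E ≃ₗᵢ[ℝ] E)}

theorem conjPoly_mem_invariants {f : MvPolynomial (Fin ℓ) ℂ} (hf : f ∈ invariants ℂ b W) :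
    conjPoly (Fin ℓ) f ∈ invariants ℂ b W :=
  map_mem_invariants Complex.conjAe.toAlgHom hf

theorem toSc_mem_invariants {f : MvPolynomial (Fin ℓ) ℂ} (hf : f ∈ invariants ℂ b W) :
    toSc ℓ W f ∈ invariants (ParamField W) b W :=
  map_mem_invariants (IsScalarTower.toAlgHom ℝ ℂ (ParamField W)) hf

theorem sum_act_mem_invariants [Fintype W] (k : Type*) [Field k] [Algebra ℝ k]
    (f : MvPolynomial (Fin ℓ) k) : ∑ w : W, act k b w f ∈ invariants k b W := by
  intro w hw
  rw [map_sum]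
  refine Fintype.sum_equiv (Equiv.mulLeft (⟨w, hw⟩ : W)) _ _ fun w' => ?_
  rw [← act_mul_apply]
  rfl

theorem sum_act_mem_span_toSc [Fintype W] (f : Sc ℓ W) :
    ∑ w : W, act _ b w f ∈ Submodule.span (ParamField W)
      (toSc ℓ W '' (invariants ℂ b W : Set (MvPolynomial (Fin ℓ) ℂ))) := by
  induction f using MvPolynomial.induction_on' with
  | monomial m r =>
    have hm : monomial m r = r • toSc ℓ W (monomial m 1) := by
      rw [toSc, map_monomial, map_one, smul_monomial, smul_eq_mul, mul_one]
    simp only [hm, map_smul, ← toSc_act, ← Finset.smul_sum, ← map_sum]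
    exact Submodule.smul_mem _ _ (Submodule.subset_span ⟨_, sum_act_mem_invariants ℂ _, rfl⟩)
  | add p q hp hq =>
    simp only [map_add, Finset.sum_add_distrib]
    exact add_mem hp hq

theorem mem_span_toSc_of_mem_invariants [Finite W] {f : Sc ℓ W}
    (hf : f ∈ invariants (ParamField W) b W) :
    f ∈ Submodule.span (ParamField W)
      (toSc ℓ W '' (invariants ℂ b W : Set (MvPolynomial (Fin ℓ) ℂ))) := by
  have := Fintype.ofFinite W
  have hcard : (Fintype.card W : ParamField W) ≠ 0 := Nat.cast_ne_zero.mpr Fintype.card_ne_zero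
  have hsum : ∑ w : W, act _ b w f = (Fintype.card W : ParamField W) • f := by
    rw [Finset.sum_congr rfl fun (w : W) _ => hf w w.2, Finset.sum_const, Finset.card_univ,
      Nat.cast_smul_eq_nsmul]
  have hmem := sum_act_mem_span_toSc (b := b) f
  rwa [hsum, Submodule.smul_mem_iff _ hcard] at hmem

variable {d : Fin ℓ → ℕ} {u : Fin ℓ → MvPolynomial (Fin ℓ) ℂ}

theorem isHomogeneousGeneratingSet_iff : IsHomogeneousGeneratingSet b W d u ↔
    IsHomogeneousGenerators (invariants ℂ b W) d u :=
  ⟨fun ⟨h, h', h''⟩ => ⟨h, h', h''⟩, fun ⟨h, h', h''⟩ => ⟨h, h', h''⟩⟩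

theorem toSc_powProd {r : ℕ} (u : Fin r → MvPolynomial (Fin ℓ) ℂ) (a : Fin r → ℕ) :
    toSc ℓ W (powProd u a) = powProd (toSc ℓ W ∘ u) a :=
  map_powProd (toSc ℓ W).toMonoidHom u a

theorem toSc_comp_powProd {r : ℕ} (u : Fin r → MvPolynomial (Fin ℓ) ℂ) :
    toSc ℓ W ∘ powProd u = powProd (toSc ℓ W ∘ u) :=
  funext (toSc_powProd u)

theorem monom_eq_powProd (u : Fin ℓ → MvPolynomial (Fin ℓ) ℂ) (a : Fin ℓ → ℕ) :
    monom W u a = powProd (toSc ℓ W ∘ u) a :=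
  toSc_powProd u a

theorem toSc_mem_span_powProd {r : ℕ} {u : Fin r → MvPolynomial (Fin ℓ) ℂ}
    {s : Set (Fin r → ℕ)} {g : MvPolynomial (Fin ℓ) ℂ}
    (hg : g ∈ Submodule.span ℂ (powProd u '' s)) :
    toSc ℓ W g ∈ Submodule.span (ParamField W) (powProd (toSc ℓ W ∘ u) '' s) := by
  rw [← toSc_comp_powProd, Set.image_comp]
  exact map_mem_span (ParamField W) hg

theorem IsHomogeneousGenerators.map_toSc [Finite W]
    (hu : IsHomogeneousGenerators (invariants ℂ b W) d u) :
    IsHomogeneousGenerators (invariants (ParamField W) b W) d (toSc ℓ W ∘ u) where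
  isHomogeneous i := (hu.isHomogeneous i).map _
  algebraicIndependent := algebraicIndependent_map (ParamField W) hu.algebraicIndependent
  adjoin_eq := by
    refine le_antisymm (Algebra.adjoin_le ?_) fun f hf => ?_
    · rintro _ ⟨i, rfl⟩
      exact toSc_mem_invariants (hu.mem i)
    · rw [← Subalgebra.mem_toSubmodule, ← span_range_powProd, ← Set.image_univ]
      refine Submodule.span_le.mpr ?_ (mem_span_toSc_of_mem_invariants hf)
      rintro _ ⟨g, hg, rfl⟩
      refine toSc_mem_span_powProd ?_
      rwa [Set.image_univ, span_range_powProd, hu.adjoin_eq]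

theorem conjPoly_powProd_mem_lowerSpan (hu : IsHomogeneousGenerators (invariants ℂ b W) d u)
    (hd : StrictMono d) {a a' : Fin ℓ → ℕ} (h : a' ∈ lowerExponents d a) :
    conjPoly (Fin ℓ) (powProd u a') ∈ lowerSpan ℂ u d a := by
  have hmap : conjPoly (Fin ℓ) (powProd u a') = powProd (conjPoly (Fin ℓ) ∘ u) a' :=
    map_powProd (conjPoly (Fin ℓ)).toMonoidHom u a'
  rw [hmap]
  exact powProd_mem_lowerSpan (hu.mem_leadSpan_single_one hd
    (fun i => conjPoly_mem_invariants (hu.mem i)) fun i => (hu.isHomogeneous i).map _) h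

end Invariants

section Orthogonality

variable {b : OrthonormalBasis (Fin ℓ) ℝ E} {W : Subgroup (E ≃ₗᵢ[ℝ] E)} [Finite W]

theorem dunklForm_eq_zero_of_mem_span {s : Set (Sc ℓ W)} {f g : Sc ℓ W}
    (h : ∀ x ∈ s, dunklForm b W x f = 0) (hg : g ∈ Submodule.span (ParamField W) s) :
    dunklForm b W g f = 0 := by
  simp only [← dunklBilin_apply] at h ⊢
  exact (Submodule.span_le (p := LinearMap.ker ((dunklBilin b W).flip f))).mpr h hg

section Monomials

variable {r : ℕ} {u : Fin r → MvPolynomial (Fin ℓ) ℂ} {s : Set (Fin r → ℕ)}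

theorem eq_zero_of_dunklForm_powProd_eq_zero (hu : AlgebraicIndependent ℂ u) (hs : s.Finite)
    (hconj : ∀ a ∈ s, conjPoly (Fin ℓ) (powProd u a) ∈ Submodule.span ℂ (powProd u '' s))
    {g : Sc ℓ W} (hg : g ∈ Submodule.span (ParamField W) (powProd (toSc ℓ W ∘ u) '' s))
    (h : ∀ a ∈ s, dunklForm b W (powProd (toSc ℓ W ∘ u) a) g = 0) : g = 0 := by
  have := hs.to_subtype
  rw [← toSc_comp_powProd] at hg h
  rw [Set.image_eq_range] at hg hconj
  exact eq_zero_of_dunklForm_toSc_eq_zero b (v := fun a : s => powProd u a)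
    ((linearIndependent_powProd hu).comp _ Subtype.val_injective) (fun a => hconj a a.2) hg
    fun a => h a a.2

theorem exists_dunklForm_powProd_sub_eq_zero (hu : AlgebraicIndependent ℂ u) (hs : s.Finite)
    (hconj : ∀ a ∈ s, conjPoly (Fin ℓ) (powProd u a) ∈ Submodule.span ℂ (powProd u '' s))
    (g : Sc ℓ W) : ∃ x ∈ Submodule.span (ParamField W) (powProd (toSc ℓ W ∘ u) '' s),
      ∀ a ∈ s, dunklForm b W (powProd (toSc ℓ W ∘ u) a) (g - x) = 0 := by
  have := hs.to_subtype
  rw [← toSc_comp_powProd]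
  rw [Set.image_eq_range] at hconj ⊢
  obtain ⟨x, hx, h⟩ := exists_dunklForm_toSc_sub_eq_zero b (v := fun a : s => powProd u a)
    ((linearIndependent_powProd hu).comp _ Subtype.val_injective) (fun a => hconj a a.2) g
  exact ⟨x, hx, fun a ha => h ⟨a, ha⟩⟩

end Monomials

variable {d : Fin ℓ → ℕ} {u : Fin ℓ → MvPolynomial (Fin ℓ) ℂ}

theorem eq_zero_of_mem_invariants (hu : IsHomogeneousGenerators (invariants ℂ b W) d u)
    {g : Sc ℓ W} (hg : g ∈ invariants (ParamField W) b W)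
    (h : ∀ a, dunklForm b W (powProd (toSc ℓ W ∘ u) a) g = 0) : g = 0 := by
  refine eq_zero_of_dunklForm_powProd_eq_zero hu.algebraicIndependent
    (finite_dotProduct_le hu.degree_pos g.totalDegree) (fun a ha => ?_) ?_ fun a _ => h a
  · refine Submodule.span_mono (Set.image_mono ?_) (hu.mem_span_of_isHomogeneous
      (conjPoly_mem_invariants (hu.powProd_mem a))
      ((powProd_isHomogeneous hu.isHomogeneous a).map _))
    exact fun a' h' => (Eq.le h').trans ha
  · refine Submodule.span_mono (Set.image_mono fun a ha => ?_)
      (hu.map_toSc.mem_span_of_homogeneousComponent_ne_zero hg)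
    exact not_lt.mp fun hlt => ha (homogeneousComponent_eq_zero _ _ hlt)

end Orthogonality

section Canonical

variable {b : OrthonormalBasis (Fin ℓ) ℝ E} {W : Subgroup (E ≃ₗᵢ[ℝ] E)}
  {d : Fin ℓ → ℕ} {u v : Fin ℓ → MvPolynomial (Fin ℓ) ℂ} {a : Fin ℓ → ℕ} {e f : Sc ℓ W}

/-- The conditions on a canonical invariant `b_a` with respect to a single homogeneous generating
set `u`, using only the monomials `u^{a'}` of the same degree as `u^a`. When the degrees are
pairwise distinct they do not depend on `u`. -/
structure IsCanonicalFor (b : OrthonormalBasis (Fin ℓ) ℝ E) (W : Subgroup (E ≃ₗᵢ[ℝ] E))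
    (d : Fin ℓ → ℕ) (u : Fin ℓ → MvPolynomial (Fin ℓ) ℂ) (a : Fin ℓ → ℕ) (f : Sc ℓ W) : Prop where
  mem_invariants : f ∈ invariants (ParamField W) b W
  isHomogeneous : f.IsHomogeneous (d ⬝ᵥ a)
  exists_lead : ∃ z : ℂ, z ≠ 0 ∧
    f - z • powProd (toSc ℓ W ∘ u) a ∈ lowerSpan (ParamField W) (toSc ℓ W ∘ u) d a
  orthogonal : ∀ a' ∈ lowerExponents d a, dunklForm b W (powProd (toSc ℓ W ∘ u) a') f = 0

theorem isCanonicalInvariant_iff : IsCanonicalInvariant b W a f ↔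
    f ∈ invariants (ParamField W) b W ∧ (∃ n, f.IsHomogeneous n) ∧
      ∀ u, IsHomogeneousGenerators (invariants ℂ b W) (degrees b W) u →
        (∃ z : ℂ, z ≠ 0 ∧ f - z • powProd (toSc ℓ W ∘ u) a ∈
          Submodule.span (ParamField W) (powProd (toSc ℓ W ∘ u) '' {a' | Prec a' a})) ∧
        ∀ a', Prec a' a → dunklForm b W (powProd (toSc ℓ W ∘ u) a') f = 0 := by
  have himage (u : Fin ℓ → MvPolynomial (Fin ℓ) ℂ) :
      {g | ∃ a', Prec a' a ∧ g = powProd (toSc ℓ W ∘ u) a'} =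
        powProd (toSc ℓ W ∘ u) '' {a' | Prec a' a} :=
    Set.ext fun g => exists_congr fun a' => and_congr_right fun _ => eq_comm
  simp only [IsCanonicalInvariant, isHomogeneousGeneratingSet_iff, monom_eq_powProd, himage]

theorem toSc_smul (z : ℂ) (g : MvPolynomial (Fin ℓ) ℂ) : toSc ℓ W (z • g) = z • toSc ℓ W g := by
  rw [smul_eq_C_mul, map_mul, toSc_C, ← smul_eq_C_mul, algebraMap_smul]

theorem IsCanonicalFor.exists_sub_smul_mem_lowerSpan (he : IsCanonicalFor b W d u a e)
    (hf : f ∈ leadSpan (ParamField W) (toSc ℓ W ∘ u) d a) : ∃ r : ParamField W,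
      f - r • e ∈ lowerSpan (ParamField W) (toSc ℓ W ∘ u) d a := by
  obtain ⟨r, hr⟩ := mem_leadSpan_iff.mp hf
  obtain ⟨z, hz, hlead⟩ := he.exists_lead
  have hz' : algebraMap ℂ (ParamField W) z ≠ 0 := (map_ne_zero _).mpr hz
  refine ⟨r * (algebraMap ℂ (ParamField W) z)⁻¹, ?_⟩
  have h := sub_mem hr (Submodule.smul_mem _ (r * (algebraMap ℂ (ParamField W) z)⁻¹) hlead)
  rwa [smul_sub, ← algebraMap_smul (ParamField W) z, smul_smul, inv_mul_cancel_right₀ hz',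
    sub_sub_sub_cancel_right] at h

section Finite

variable [Finite W]

theorem IsCanonicalFor.ne_zero (he : IsCanonicalFor b W d u a e)
    (hu : IsHomogeneousGenerators (invariants ℂ b W) d u) : e ≠ 0 := by
  rintro rfl
  obtain ⟨z, hz, h⟩ := he.exists_lead
  rw [zero_sub, neg_mem_iff, ← algebraMap_smul (ParamField W) z,
    Submodule.smul_mem_iff _ ((map_ne_zero _).mpr hz)] at h
  exact hu.map_toSc.powProd_notMem_lowerSpan a h

theorem isCanonicalFor_of_mem_span_prec (hu : IsHomogeneousGenerators (invariants ℂ b W) d u)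
    (hf : f ∈ invariants (ParamField W) b W) {n : ℕ} (hn : f.IsHomogeneous n) {z : ℂ} (hz : z ≠ 0)
    (hlead : f - z • powProd (toSc ℓ W ∘ u) a ∈
      Submodule.span (ParamField W) (powProd (toSc ℓ W ∘ u) '' {a' | Prec a' a}))
    (horth : ∀ a', Prec a' a → dunklForm b W (powProd (toSc ℓ W ∘ u) a') f = 0) :
    IsCanonicalFor b W d u a f := by
  have hpow := powProd_isHomogeneous hu.map_toSc.isHomogeneous
  have hcomp : homogeneousComponent (d ⬝ᵥ a) f - z • powProd (toSc ℓ W ∘ u) a ∈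
      lowerSpan (ParamField W) (toSc ℓ W ∘ u) d a := by
    rw [Set.image_eq_range] at hlead
    have hmem := homogeneousComponent_mem_span (δ := fun a' : {a' | Prec a' a} => d ⬝ᵥ a'.1)
      (fun a' => hpow a') hlead (d ⬝ᵥ a)
    rw [← algebraMap_smul (ParamField W) z, map_sub, map_smul,
      homogeneousComponent_eq_self (hpow a), algebraMap_smul] at hmem
    refine Submodule.span_mono ?_ hmem
    rintro _ ⟨a', ha', rfl⟩
    exact ⟨a', ⟨a'.2, ha'⟩, rfl⟩
  have hdeg : n = d ⬝ᵥ a := by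
    by_contra hne
    rw [homogeneousComponent_of_mem hn, if_neg (Ne.symm hne), zero_sub, neg_mem_iff,
      ← algebraMap_smul (ParamField W) z,
      Submodule.smul_mem_iff _ ((map_ne_zero _).mpr hz)] at hcomp
    exact hu.map_toSc.powProd_notMem_lowerSpan a hcomp
  subst hdeg
  rw [homogeneousComponent_eq_self hn] at hcomp
  exact ⟨hf, hn, ⟨z, hz, hcomp⟩, fun a' ha' => horth a' ha'.1⟩

theorem IsCanonicalInvariant.isCanonicalFor (hf : IsCanonicalInvariant b W a f)
    (hu : IsHomogeneousGenerators (invariants ℂ b W) (degrees b W) u) :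
    IsCanonicalFor b W (degrees b W) u a f := by
  obtain ⟨hinv, ⟨n, hn⟩, h⟩ := isCanonicalInvariant_iff.mp hf
  obtain ⟨⟨z, hz, hlead⟩, horth⟩ := h u hu
  exact isCanonicalFor_of_mem_span_prec hu hinv hn hz hlead horth

theorem IsCanonicalFor.of_isHomogeneousGenerators (hf : IsCanonicalFor b W d u a f)
    (hu : IsHomogeneousGenerators (invariants ℂ b W) d u)
    (hv : IsHomogeneousGenerators (invariants ℂ b W) d v) (hd : StrictMono d) :
    IsCanonicalFor b W d v a f where
  mem_invariants := hf.mem_invariants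
  isHomogeneous := hf.isHomogeneous
  exists_lead := by
    obtain ⟨z, hz, hlead⟩ := hf.exists_lead
    obtain ⟨z', hz', h⟩ := hu.exists_sub_smul_mem_lowerSpan hv hd a
    refine ⟨z * z', mul_ne_zero hz hz', ?_⟩
    have hmem := toSc_mem_span_powProd (W := W) h
    rw [map_sub, toSc_smul, toSc_powProd, toSc_powProd] at hmem
    have hsum := add_mem ((hu.map_toSc.lowerSpan_eq hv.map_toSc hd a).le hlead)
      (Submodule.smul_of_tower_mem _ z hmem)
    rwa [smul_sub, sub_add_sub_cancel, smul_smul] at hsum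
  orthogonal a' ha' := by
    refine dunklForm_eq_zero_of_mem_span (s := powProd (toSc ℓ W ∘ u) '' lowerExponents d a) ?_ ?_
    · rintro _ ⟨a'', ha'', rfl⟩
      exact hf.orthogonal a'' ha''
    · rw [← lowerSpan, hu.map_toSc.lowerSpan_eq hv.map_toSc hd a]
      exact Submodule.subset_span ⟨a', ha', rfl⟩

theorem IsCanonicalFor.dunklForm_powProd_eq_zero_of_prec (hf : IsCanonicalFor b W d u a f)
    (hu : IsHomogeneousGenerators (invariants ℂ b W) d u) {a' : Fin ℓ → ℕ} (h : Prec a' a) :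
    dunklForm b W (powProd (toSc ℓ W ∘ u) a') f = 0 := by
  by_cases hdeg : d ⬝ᵥ a' = d ⬝ᵥ a
  · exact hf.orthogonal a' ⟨h, hdeg⟩
  · exact dunklForm_eq_zero_of_degree_ne b W
      (powProd_isHomogeneous hu.map_toSc.isHomogeneous a') hf.isHomogeneous hdeg

theorem IsCanonicalFor.isCanonicalInvariant (hf : IsCanonicalFor b W (degrees b W) u a f)
    (hu : IsHomogeneousGenerators (invariants ℂ b W) (degrees b W) u)
    (hd : StrictMono (degrees b W)) : IsCanonicalInvariant b W a f := by
  refine isCanonicalInvariant_iff.mpr ⟨hf.mem_invariants, ⟨_, hf.isHomogeneous⟩, fun v hv => ?_⟩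
  have hf' := hf.of_isHomogeneousGenerators hu hv hd
  obtain ⟨z, hz, hlead⟩ := hf'.exists_lead
  exact ⟨⟨z, hz, Submodule.span_mono (Set.image_mono fun _ h => h.1) hlead⟩,
    fun _ => hf'.dunklForm_powProd_eq_zero_of_prec hv⟩

theorem exists_isCanonicalFor (hu : IsHomogeneousGenerators (invariants ℂ b W) d u)
    (hd : StrictMono d) (a : Fin ℓ → ℕ) : ∃ f, IsCanonicalFor b W d u a f := by
  obtain ⟨x, hx, horth⟩ := exists_dunklForm_powProd_sub_eq_zero (b := b) hu.algebraicIndependent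
    (finite_lowerExponents hu.degree_pos a) (fun _ => conjPoly_powProd_mem_lowerSpan hu hd)
    (powProd (toSc ℓ W ∘ u) a)
  have hhom := hu.map_toSc.isHomogeneous
  refine ⟨powProd (toSc ℓ W ∘ u) a - x, sub_mem (hu.map_toSc.powProd_mem a)
    (hu.map_toSc.lowerSpan_le a hx), (powProd_isHomogeneous hhom a).sub
      (isHomogeneous_of_mem_lowerSpan hhom hx), ⟨1, one_ne_zero, ?_⟩, horth⟩
  rw [one_smul, sub_sub_cancel_left]
  exact neg_mem hx

theorem IsElementary.isCanonicalFor (he : IsElementary b W (degrees b W ⬝ᵥ a) e)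
    (ha : IsLargestExponent (degrees b W) a)
    (hu : IsHomogeneousGenerators (invariants ℂ b W) (degrees b W) u) :
    IsCanonicalFor b W (degrees b W) u a e := by
  obtain ⟨a', hdeg, hlargest, hcan⟩ := he
  obtain rfl | hlt := ha a' hdeg
  · exact hcan.isCanonicalFor hu
  · obtain rfl | hgt := hlargest a rfl
    · exact hcan.isCanonicalFor hu
    · exact absurd (hlt.trans hgt) (not_prec_self a')

theorem exists_isElementary (ha : IsLargestExponent (degrees b W) a)
    (hu : IsHomogeneousGenerators (invariants ℂ b W) (degrees b W) u)
    (hd : StrictMono (degrees b W)) : ∃ e, IsElementary b W (degrees b W ⬝ᵥ a) e := by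
  obtain ⟨e, he⟩ := exists_isCanonicalFor hu hd a
  exact ⟨e, a, rfl, ha, he.isCanonicalInvariant hu hd⟩

theorem adjoin_eq_invariants (hu : IsHomogeneousGenerators (invariants ℂ b W) d u)
    {e : Fin ℓ → Sc ℓ W} (he : ∀ k, IsCanonicalFor b W d u (Pi.single k 1) (e k)) :
    Algebra.adjoin (ParamField W) (Set.range e) = invariants (ParamField W) b W := by
  refine le_antisymm (Algebra.adjoin_le ?_) ?_
  · rintro _ ⟨k, rfl⟩
    exact (he k).mem_invariants
  · choose z hz hlead using fun k => (he k).exists_lead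
    rw [← hu.map_toSc.adjoin_eq]
    refine Algebra.adjoin_le ?_
    rintro _ ⟨k, rfl⟩
    refine mem_of_triangular (d := d) (u := toSc ℓ W ∘ u)
      (z := fun i => (Units.mk0 _ (hz i)).map (algebraMap ℂ (ParamField W)).toMonoidHom)
      (fun i => Algebra.subset_adjoin (Set.mem_range_self i)) (fun i => ?_) k
    have h := hlead i
    rw [← algebraMap_smul (ParamField W) (z i), powProd_single, pow_one] at h
    exact h

end Finite

end Canonical

section DunklEquations

variable {b : OrthonormalBasis (Fin ℓ) ℝ E} {W : Subgroup (E ≃ₗᵢ[ℝ] E)} [Finite W]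
  {d : Fin ℓ → ℕ} {u : Fin ℓ → MvPolynomial (Fin ℓ) ℂ} {a : Fin ℓ → ℕ} {e f : Sc ℓ W}

theorem IsCanonicalFor.dunklForm_powProd_eq_zero_of_ne (he : IsCanonicalFor b W d u a e)
    (hu : IsHomogeneousGenerators (invariants ℂ b W) d u) (ha : IsLargestExponent d a)
    {a' : Fin ℓ → ℕ} (h : a' ≠ a) : dunklForm b W (powProd (toSc ℓ W ∘ u) a') e = 0 := by
  by_cases hdeg : d ⬝ᵥ a' = d ⬝ᵥ a
  · exact he.orthogonal a' ⟨(ha a' hdeg).resolve_left h, hdeg⟩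
  · exact dunklForm_eq_zero_of_degree_ne b W
      (powProd_isHomogeneous hu.map_toSc.isHomogeneous a') he.isHomogeneous hdeg

theorem IsCanonicalFor.dunklPoly_eq_zero {k : Fin ℓ} {n : ℕ}
    (he : IsCanonicalFor b W d u (Pi.single k n) e)
    (hu : IsHomogeneousGenerators (invariants ℂ b W) d u)
    (ha : IsLargestExponent d (Pi.single k n)) {P : Sc ℓ W}
    (hP : P ∈ invariants (ParamField W) b W) (hP0 : constantCoeff P = 0)
    (hdeg : P.totalDegree < d k) : dunklPoly b W P e = 0 := by
  refine eq_zero_of_mem_invariants hu (dunklPoly_mem_invariants b W hP he.mem_invariants)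
    fun q => ?_
  rw [← dunklForm_mul_left, mul_comm, dunklForm_mul_left]
  refine dunklForm_eq_zero_of_mem_span ?_
    (hu.map_toSc.mem_span_of_homogeneousComponent_ne_zero hP)
  rintro _ ⟨p, hp, rfl⟩
  rw [← dunklForm_mul_left, mul_comm, ← powProd_add]
  refine he.dunklForm_powProd_eq_zero_of_ne hu ha fun hqp => hp ?_
  have hlt : d ⬝ᵥ p < d k :=
    (not_lt.mp fun hlt => hp (homogeneousComponent_eq_zero _ _ hlt)).trans_lt hdeg
  rw [dotProduct_eq_zero_of_add_eq_single hqp hlt, homogeneousComponent_zero, ← constantCoeff_eq,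
    hP0, C_0]

theorem dunklForm_powProd_eq_zero {i : Fin ℓ} (h : dunklPoly b W (toSc ℓ W (u i)) f = 0)
    (hai : a i ≠ 0) : dunklForm b W (powProd (toSc ℓ W ∘ u) a) f = 0 := by
  have hsplit : a = (a - Pi.single i 1) + Pi.single i 1 :=
    (tsub_add_cancel_of_le (update_le_iff.mpr
      ⟨Nat.one_le_iff_ne_zero.mpr hai, fun _ _ => Nat.zero_le _⟩)).symm
  rw [hsplit, powProd_add, powProd_single, pow_one, dunklForm_mul_left, Function.comp_apply, h,
    dunklForm, map_zero, map_zero]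

theorem IsCanonicalFor.exists_eq_smul {k : Fin ℓ} {n : ℕ}
    (he : IsCanonicalFor b W d u (Pi.single k n) e)
    (hu : IsHomogeneousGenerators (invariants ℂ b W) d u) (hd : StrictMono d)
    (ha : IsLargestExponent d (Pi.single k n)) (hf : f ∈ invariants (ParamField W) b W)
    (hn : f.IsHomogeneous (d ⬝ᵥ Pi.single k n))
    (h : ∀ i < k, dunklPoly b W (toSc ℓ W (u i)) f = 0) : ∃ r : ParamField W, f = r • e := by
  obtain ⟨r, hr⟩ := he.exists_sub_smul_mem_lowerSpan (hu.map_toSc.mem_leadSpan ha hf hn)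
  refine ⟨r, sub_eq_zero.mp ?_⟩
  refine eq_zero_of_dunklForm_powProd_eq_zero (b := b) hu.algebraicIndependent
    (finite_lowerExponents hu.degree_pos _) (fun _ => conjPoly_powProd_mem_lowerSpan hu hd) hr
    fun a ha' => ?_
  obtain ⟨i, hi, hai⟩ := exists_lt_ne_zero_of_mem_lowerExponents_single hu.degree_pos ha'
  rw [← dunklBilin_apply, map_sub, map_smul, dunklBilin_apply, dunklBilin_apply,
    he.orthogonal a ha', smul_zero, sub_zero]
  exact dunklForm_powProd_eq_zero (h i hi) hai

theorem IsCanonicalFor.tfae_eq_smul {k : Fin ℓ} {n : ℕ}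
    (he : IsCanonicalFor b W d u (Pi.single k n) e)
    (hu : IsHomogeneousGenerators (invariants ℂ b W) d u) (hd : StrictMono d)
    (ha : IsLargestExponent d (Pi.single k n)) (hf : f ∈ invariants (ParamField W) b W)
    (hn : f.IsHomogeneous (d ⬝ᵥ Pi.single k n)) :
    [∀ P ∈ invariants (ParamField W) b W, constantCoeff P = 0 → P.totalDegree < d k →
        dunklPoly b W P f = 0,
      ∀ P ∈ invariants ℂ b W, constantCoeff P = 0 → P.totalDegree < d k →
        dunklPoly b W (toSc ℓ W P) f = 0,
      ∃ r : ParamField W, f = r • e].TFAE := by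
  tfae_have 3 → 1 := by
    rintro ⟨r, rfl⟩ P hP hP0 hdeg
    rw [map_smul, he.dunklPoly_eq_zero hu ha hP hP0 hdeg, smul_zero]
  tfae_have 1 → 2 := fun h P hP hP0 hdeg => by
    refine h _ (toSc_mem_invariants hP) ?_ ?_
    · rw [toSc, constantCoeff_map, hP0, map_zero]
    · exact (Finset.sup_mono (support_map_subset _ _)).trans_lt hdeg
  tfae_have 2 → 3 := fun h => he.exists_eq_smul hu hd ha hf hn fun i hi =>
    h _ (hu.mem i) (hu.constantCoeff_eq_zero i)
      ((hu.isHomogeneous i).totalDegree_le.trans_lt (hd hi))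
  tfae_finish

end DunklEquations

section SmallRank

theorem mem_adjoin_range_X_pow_iff {k σ : Type*} [CommSemiring k] {n : ℕ}
    {f : MvPolynomial σ k} :
    f ∈ Algebra.adjoin k (Set.range fun i => (X i : MvPolynomial σ k) ^ n) ↔
      ∀ m ∈ f.support, ∀ i, n ∣ m i := by
  constructor
  · rw [Algebra.adjoin_range_eq_range_aeval]
    rintro ⟨g, rfl⟩ m hm i
    by_contra hni
    exact mem_support_iff.mp hm (coeff_expand_of_not_dvd g hni)
  · intro h
    rw [f.as_sum]
    refine sum_mem fun m hm => ?_
    rw [monomial_eq, ← smul_eq_C_mul]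
    refine Subalgebra.smul_mem _ (Subalgebra.prod_mem _ fun i _ => ?_) _
    obtain ⟨q, hq⟩ := h m hm i
    simp only [hq, pow_mul]
    exact pow_mem (Algebra.subset_adjoin (Set.mem_range_self i)) q

theorem apply_zero_eq_self_or_eq_neg (b : OrthonormalBasis (Fin 1) ℝ E) (w : E ≃ₗᵢ[ℝ] E) :
    w (b 0) = (1 : ℝ) • b 0 ∨ w (b 0) = (-1 : ℝ) • b 0 := by
  have hsmul : w (b 0) = (inner ℝ (b 0) (w (b 0)) : ℝ) • b 0 := by
    simpa using (b.sum_repr' (w (b 0))).symm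
  have hnorm : |(inner ℝ (b 0) (w (b 0)) : ℝ)| = 1 := by
    simpa [norm_smul, w.norm_map, b.norm_eq_one] using (congrArg norm hsmul).symm
  rcases eq_or_eq_neg_of_abs_eq hnorm with h | h
  · exact Or.inl (h ▸ hsmul)
  · exact Or.inr (h ▸ hsmul)

theorem coeff_act_of_apply_eq_smul (k : Type*) [Field k] [Algebra ℝ k]
    {b : OrthonormalBasis (Fin 1) ℝ E} {w : E ≃ₗᵢ[ℝ] E} {r : ℝ} (hw : w (b 0) = r • b 0)
    (f : MvPolynomial (Fin 1) k) (m : Fin 1 →₀ ℕ) :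
    coeff m (act k b w f) = algebraMap ℝ k r ^ m 0 * coeff m f := by
  have hX : act k b w (X 0) = C (algebraMap ℝ k r) * X 0 := by
    rw [act_X, hw, linForm_smul, linForm_basis]
  induction f using MvPolynomial.induction_on' with
  | monomial n z =>
    have hmonomial : monomial n z = C z * X 0 ^ n 0 := by
      rw [monomial_eq, Finsupp.prod_fintype _ _ fun i => pow_zero _, Fin.prod_univ_one]
    have hact : act k b w (monomial n z) = C (algebraMap ℝ k r ^ n 0) * monomial n z := by
      rw [hmonomial, map_mul, act_C, map_pow, hX, mul_pow, C_pow, mul_left_comm]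
    rw [hact, coeff_C_mul, coeff_monomial]
    split_ifs with h
    · rw [h]
    · rw [mul_zero, mul_zero]
  | add p q hp hq => rw [map_add, coeff_add, coeff_add, hp, hq, mul_add]

theorem exists_mem_invariants_iff_dvd (k : Type*) [Field k] [Algebra ℝ k]
    (b : OrthonormalBasis (Fin 1) ℝ E) (W : Subgroup (E ≃ₗᵢ[ℝ] E)) : ∃ n ≠ 0,
      ∀ f : MvPolynomial (Fin 1) k, f ∈ invariants k b W ↔ ∀ m ∈ f.support, n ∣ m 0 := by
  have hfix {w : E ≃ₗᵢ[ℝ] E} (hw : w (b 0) = (1 : ℝ) • b 0) (f) : act k b w f = f :=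
    MvPolynomial.ext _ _ fun m => by
      rw [coeff_act_of_apply_eq_smul k hw, map_one, one_pow, one_mul]
  by_cases h : ∀ w ∈ W, w (b 0) = (1 : ℝ) • b 0
  · exact ⟨1, one_ne_zero, fun f =>
      ⟨fun _ m _ => one_dvd _, fun _ w hw => hfix (h w hw) f⟩⟩
  push Not at h
  obtain ⟨w, hw, hw1⟩ := h
  refine ⟨2, two_ne_zero, fun f => ⟨fun hf m hm => ?_, fun hf w' _ => ?_⟩⟩
  · have hcoeff := coeff_act_of_apply_eq_smul k
      ((apply_zero_eq_self_or_eq_neg b w).resolve_left hw1) f m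
    have := charZero_of_injective_algebraMap (algebraMap ℝ k).injective
    rw [hf w hw, map_neg, map_one, eq_comm, mul_eq_right₀ (mem_support_iff.mp hm),
      neg_one_pow_eq_one_iff_even (by norm_num)] at hcoeff
    exact hcoeff.two_dvd
  · obtain hw' | hw' := apply_zero_eq_self_or_eq_neg b w'
    · exact hfix hw' f
    · refine MvPolynomial.ext _ _ fun m => ?_
      rw [coeff_act_of_apply_eq_smul k hw', map_neg, map_one]
      by_cases hm : m ∈ f.support
      · rw [(even_iff_two_dvd.mpr (hf m hm)).neg_one_pow, one_mul]
      · rw [notMem_support_iff.mp hm, mul_zero]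

theorem exists_isHomogeneousGenerators_rank_one (b : OrthonormalBasis (Fin 1) ℝ E)
    (W : Subgroup (E ≃ₗᵢ[ℝ] E)) :
    ∃ d : Fin 1 → ℕ, Monotone d ∧ ∃ u, IsHomogeneousGenerators (invariants ℂ b W) d u := by
  obtain ⟨n, hn, hinv⟩ := exists_mem_invariants_iff_dvd ℂ b W
  refine ⟨fun _ => n, monotone_const, fun i => X i ^ n, fun i => isHomogeneous_X_pow i n, ?_, ?_⟩
  · exact expand_injective hn.bot_lt
  · ext f
    simp only [mem_adjoin_range_X_pow_iff, hinv, Fin.forall_fin_one]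

theorem exists_isHomogeneousGenerators_rank_zero (b : OrthonormalBasis (Fin 0) ℝ E)
    (W : Subgroup (E ≃ₗᵢ[ℝ] E)) :
    ∃ d : Fin 0 → ℕ, Monotone d ∧ ∃ u, IsHomogeneousGenerators (invariants ℂ b W) d u := by
  refine ⟨0, monotone_const, 0, fun i => i.elim0, ?_, ?_⟩
  · rw [algebraicIndependent_empty_type_iff]
    exact C_injective _ _
  · refine SetLike.ext fun f => ?_
    rw [eq_C_of_isEmpty f]
    exact iff_of_true (Subalgebra.algebraMap_mem _ _) (Subalgebra.algebraMap_mem _ _)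

-- In rank at least two, the junk value `0` of `degrees` is not strictly increasing.
theorem exists_isHomogeneousGenerators_degrees {b : OrthonormalBasis (Fin ℓ) ℝ E}
    {W : Subgroup (E ≃ₗᵢ[ℝ] E)} (hd : StrictMono (degrees b W)) :
    ∃ u, IsHomogeneousGenerators (invariants ℂ b W) (degrees b W) u := by
  simp only [← isHomogeneousGeneratingSet_iff]
  have hex : ∃ d : Fin ℓ → ℕ, Monotone d ∧ ∃ u, IsHomogeneousGeneratingSet b W d u := by
    by_contra hnex
    have hzero : degrees b W = 0 := dif_neg hnex
    have : Subsingleton (Fin ℓ) := ⟨fun i j => hd.injective (by rw [hzero]; rfl)⟩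
    simp only [isHomogeneousGeneratingSet_iff] at hnex
    obtain rfl | rfl := Nat.le_one_iff_eq_zero_or_eq_one.mp (Fin.subsingleton_iff_le_one.mp this)
    · exact hnex (exists_isHomogeneousGenerators_rank_zero b W)
    · exact hnex (exists_isHomogeneousGenerators_rank_one b W)
  rw [show degrees b W = hex.choose from dif_pos hex]
  exact hex.choose_spec.2

end SmallRank

end Dunkl

end

theorem mainTheorem5 {E : Type*} [NormedAddCommGroup E] [InnerProductSpace ℝ E] {ℓ : ℕ}
    (b : OrthonormalBasis (Fin ℓ) ℝ E) (W : Subgroup (E ≃ₗᵢ[ℝ] E)) [Finite W]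
    (hW : Subgroup.closure {s | s ∈ W ∧ Dunkl.IsReflection s} = W)
    (hd : StrictMono (Dunkl.degrees b W)) :
    -- the canonical elementary invariants exist
    (∀ k, ∃ e, Dunkl.IsElementary b W (Dunkl.degrees b W k) e) ∧
    -- they generate the algebra of invariants
    (∀ e : Fin ℓ → Dunkl.Sc ℓ W,
      (∀ k, Dunkl.IsElementary b W (Dunkl.degrees b W k) (e k)) →
        Algebra.adjoin (Dunkl.ParamField W) (Set.range e) =
          Dunkl.invariants (Dunkl.ParamField W) b W) ∧
    -- each of them is characterized up to a multiple by its degree and the Dunkl equations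
    (∀ k, ∀ e, Dunkl.IsElementary b W (Dunkl.degrees b W k) e →
      e ∈ Dunkl.invariants (Dunkl.ParamField W) b W ∧
      e.IsHomogeneous (Dunkl.degrees b W k) ∧ e ≠ 0 ∧
      ∀ f ∈ Dunkl.invariants (Dunkl.ParamField W) b W,
        f.IsHomogeneous (Dunkl.degrees b W k) →
        ((∀ P ∈ Dunkl.invariants (Dunkl.ParamField W) b W,
            MvPolynomial.constantCoeff P = 0 → P.totalDegree < Dunkl.degrees b W k →
            Dunkl.dunklPoly b W P f = 0) ↔
          ∃ r : Dunkl.ParamField W, f = r • e)) ∧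
    -- the canonical quasiharmonic invariants; `m` is the last index, so that `h = d_m`
    (∀ m : Fin ℓ, (∀ j, j ≤ m) → ∀ k : ℕ, 1 ≤ k →
      ∃ e, Dunkl.IsElementary b W (k * Dunkl.degrees b W m) e ∧
        e ∈ Dunkl.invariants (Dunkl.ParamField W) b W ∧
        e.IsHomogeneous (k * Dunkl.degrees b W m) ∧ e ≠ 0 ∧
        ∀ f ∈ Dunkl.invariants (Dunkl.ParamField W) b W,
          f.IsHomogeneous (k * Dunkl.degrees b W m) →
          ((∀ P ∈ Dunkl.invariants ℂ b W,
              MvPolynomial.constantCoeff P = 0 → P.totalDegree < Dunkl.degrees b W m →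
              Dunkl.dunklPoly b W (Dunkl.toSc ℓ W P) f = 0) ↔
            ∃ r : Dunkl.ParamField W, f = r • e)) := by
  obtain ⟨u, hu⟩ := Dunkl.exists_isHomogeneousGenerators_degrees hd
  have hdeg (k) : Dunkl.degrees b W k = Dunkl.degrees b W ⬝ᵥ Pi.single k 1 := by simp
  have hlargest := Dunkl.isLargestExponent_single_one hu.degree_pos hd
  have hcan (k e) (he : Dunkl.IsElementary b W (Dunkl.degrees b W k) e) :
      Dunkl.IsCanonicalFor b W (Dunkl.degrees b W) u (Pi.single k 1) e :=
    Dunkl.IsElementary.isCanonicalFor (hdeg k ▸ he) (hlargest k) hu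
  refine ⟨fun k => ?_, fun e he => ?_, fun k e he => ?_, fun m hm k hk => ?_⟩
  · rw [hdeg k]
    exact Dunkl.exists_isElementary (hlargest k) hu hd
  · exact Dunkl.adjoin_eq_invariants hu fun k => hcan k (e k) (he k)
  · have hc := hcan k e he
    exact ⟨hc.mem_invariants, hdeg k ▸ hc.isHomogeneous, hc.ne_zero hu, fun f hf hn =>
      (hc.tfae_eq_smul hu hd (hlargest k) hf (hdeg k ▸ hn)).out 0 2⟩
  · have hlargest' := Dunkl.isLargestExponent_single_last hu.degree_pos hm k
    have hdeg' : k * Dunkl.degrees b W m = Dunkl.degrees b W ⬝ᵥ Pi.single m k := by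
      simp [mul_comm]
    rw [hdeg']
    obtain ⟨e, he⟩ := Dunkl.exists_isElementary hlargest' hu hd
    have hc := he.isCanonicalFor hlargest' hu
    exact ⟨e, he, hc.mem_invariants, hc.isHomogeneous, hc.ne_zero hu, fun f hf hn =>
      (hc.tfae_eq_smul hu hd hlargest' hf hn).out 1 2⟩
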